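/- Let $c>0$ and write $L^2=L^2(\mathbb R^3)\otimes\mathbb R^3$. Let $\mathbf E_0,\mathbf B_0\in L^2$, $\rho\in C(\mathbb R,L^2(\mathbb R^3))$ and $\mathbf j\in C(\mathbb R,L^2)$ be real-valued and satisfy, in the sense of distributions, $$\operatorname{div}\mathbf E_0=4\pi\rho(0),\qquad \operatorname{div}\mathbf B_0=0 \quad\text{on }\mathbb R^3,\qquad \dot\rho+\operatorname{div}\mathbf j=0\quad\text{on }\mathbb R\times\mathbb R^3 .$$ Consider the Cauchy problem for the Maxwell equations (in the sense of distributions on $\mathbb R\times\mathbb R^3$) $$\operatorname{div}\mathbf E=4\pi\rho,\quad \operatorname{rot}\mathbf E=-\tfrac1c\dot{\mathbf B},\quad \operatorname{div}\mathbf B=0,\quad \operatorname{rot}\mathbf B=\tfrac{4\pi}c\,\mathbf j+\tfrac1c\dot{\mathbf E},\qquad \mathbf E|_{t=0}=\mathbf E_0,\ \ \mathbf B|_{t=0}=\mathbf B_0 .$$ Then: i) The Cauchy problem has a unique solution $(\mathbf E,\mathbf B)\in C(\mathbb R,L^2\oplus L^2)$. ii) If $\mathbf j\equiv0$, the energy is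 conserved: $\int_{\mathbb R^3}\big[|\mathbf E(t,x)|^2+|\mathbf B(t,x)|^2\big]\,dx=\int_{\mathbb R^3}\big[|\mathbf E_0(x)|^2+|\mathbf B_0(x)|^2\big]\,dx$ for all $t\in\mathbb R$. iii) Let $K(t)=\frac1{4\pi t}\,\delta(|x|-|t|)$ be the Kirchhoff kernel, i.e. $\langle K(t),\varphi\rangle=\frac1{4\pi t}\int_{|x|=|t|}\varphi\,dS$ for $t\ne0$, and $K(0)=0$. For every test function $\varphi$ the function $t\mapsto\langle K(t),\varphi\rangle$ is differentiable on $\mathbb R$, and its derivative at $t$ is $\langle\partial_tK(t),\varphi\rangle$ for a distribution $\partial_tK(t)$. Put $$\mathbf M(t)=\begin{pmatrix}(\partial_tK)(ct)&\operatorname{rot}\circ K(ct)\\-\operatorname{rot}\circ K(ct)&(\partial_tK)(ct)\end{pmatrix},\qquad \mathbf G(t)=c\begin{pmatrix}-\nabla K(ct)&-(\partial_tK)(ct)\\0&\operatorname{rot}\circ K(ct)\end{pmatrix},$$ where $\operatorname{rot}\circ K$ is the $3\times3$ matrix of distributions with $(\operatorname{rot}\circ K)*\mathbf F=\operatorname{rot}(K*\mathbf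 F)$. For every $t\in\mathbb R$, the $6\times6$ resp. $6\times4$ matrix-valued distributions $\mathbf M(t)$ and $\mathbf G(t)$ are concentrated on the sphere $|x|=c|t|$, i.e. they vanish on the open set $\{|x|\ne c|t|\}$, and $$\begin{pmatrix}\mathbf E(t)\\\mathbf B(t)\end{pmatrix}=\mathbf M(t)*\begin{pmatrix}\mathbf E_0\\\mathbf B_0\end{pmatrix}+4\pi\int_0^t\mathbf G(t-s)*\begin{pmatrix}\rho(s)\\\frac1c\,\mathbf j(s)\end{pmatrix}ds,\qquad t\in\mathbb R,$$ as distributions on $\mathbb R^3$ (the integral in $s$ being taken after pairing with a test function, where the integrand is integrable on $[0,t]$). -/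

import Mathlib

open MeasureTheory TopologicalSpace
open scoped Distributions LineDeriv ENNReal

noncomputable section

namespace Maxwell

/-- Physical space `ℝ³` with the Euclidean norm. -/
abbrev Space : Type := EuclideanSpace ℝ (Fin 3)

/-- `L²(ℝ³)`, real valued. -/
abbrev L2 : Type := Lp ℝ 2 (volume : Measure Space)

/-- `L²(ℝ³) ⊗ ℝ³`, vector valued. -/
abbrev L2V : Type := Lp Space 2 (volume : Measure Space)

/-- Test functions on `ℝ³`. -/
abbrev Test : Type := 𝓓((⊤ : Opens Space), ℝ)

/-- Distributions on `ℝ³`. -/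
abbrev Dist : Type := 𝓓'((⊤ : Opens Space), ℝ)

/-- Test functions on space-time `ℝ × ℝ³`. -/
abbrev STTest : Type := 𝓓((⊤ : Opens (ℝ × Space)), ℝ)

/-- Standard basis vector of `ℝ³`. -/
abbrev e (i : Fin 3) : Space := EuclideanSpace.single i 1

/-! ### Distributional derivatives of time-dependent fields -/

/-- The value at `φ` of the distribution on `ℝ × ℝ³` given by the function `u(t, x)`. -/
def pair (u : ℝ → Space → ℝ) (φ : STTest) : ℝ := ∫ t, ∫ x, u t x * φ (t, x)

/-- `⟨∂ₜ u, φ⟩`. -/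
def dt (u : ℝ → Space → ℝ) (φ : STTest) : ℝ := -pair u (∂_{((1 : ℝ), (0 : Space))} φ)

/-- `⟨∂u/∂xᵢ, φ⟩`. -/
def dx (i : Fin 3) (u : ℝ → Space → ℝ) (φ : STTest) : ℝ := -pair u (∂_{((0 : ℝ), e i)} φ)

/-- The `i`-th component of a vector field. -/
def comp (F : ℝ → L2V) (i : Fin 3) : ℝ → Space → ℝ := fun t x => F t x i

/-- `⟨div F, φ⟩`. -/
def divST (F : ℝ → L2V) (φ : STTest) : ℝ := ∑ i, dx i (comp F i) φ

/-- `⟨(rot F)ᵢ, φ⟩`; the indices of `Fin 3` are cyclic. -/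
def rotST (F : ℝ → L2V) (i : Fin 3) (φ : STTest) : ℝ :=
  dx (i + 1) (comp F (i + 2)) φ - dx (i + 2) (comp F (i + 1)) φ

/-- The Maxwell equations in Gaussian units, in the sense of distributions on `ℝ × ℝ³`. -/
structure Equations (c : ℝ) (ρ : ℝ → L2) (j E B : ℝ → L2V) : Prop where
  divE : ∀ φ, divST E φ = 4 * Real.pi * pair (fun t => ρ t) φ
  rotE : ∀ i φ, rotST E i φ = -(1 / c) * dt (comp B i) φ
  divB : ∀ φ, divST B φ = 0
  rotB : ∀ i φ, rotST B i φ = 4 * Real.pi / c * pair (comp j i) φ + 1 / c * dt (comp E i) φ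

/-- The Cauchy problem: `u = (E, B)` solves the Maxwell equations and `u(0) = (E₀, B₀)`. -/
structure IsSolution (c : ℝ) (E₀ B₀ : L2V) (ρ : C(ℝ, L2)) (j : C(ℝ, L2V))
    (u : C(ℝ, L2V × L2V)) : Prop where
  equations : Equations c ρ j (fun t => (u t).1) (fun t => (u t).2)
  initial : u 0 = (E₀, B₀)

/-- Charge continuity `∂ₜρ + div j = 0` in the sense of distributions on `ℝ × ℝ³`. -/
def ChargeContinuity (ρ : ℝ → L2) (j : ℝ → L2V) : Prop :=
  ∀ φ, dt (fun t => ρ t) φ + divST j φ = 0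

/-- `div F = f` in the sense of distributions on `ℝ³`. -/
def HasDiv (F : L2V) (f : Space → ℝ) : Prop :=
  ∀ φ : Test, -∑ i, ∫ x, F x i * (∂_{e i} φ) x = ∫ x, f x * φ x

/-! ### The Kirchhoff kernel -/

/-- Surface measure of the sphere `|x| = r`, `r ≥ 0`. -/
def surfaceMeasure (r : ℝ) : Measure Space :=
  ENNReal.ofReal (r ^ 2) •
    (volume : Measure Space).toSphere.map (fun ω : Metric.sphere (0 : Space) 1 => r • (ω : Space))

instance (r : ℝ) : IsFiniteMeasure (surfaceMeasure r) := by
  unfold surfaceMeasure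
  exact Measure.smul_finite _ ENNReal.ofReal_ne_top

/-- The distribution `δ(|x| - r)`, for `r ≥ 0`. -/
def deltaSphere (r : ℝ) : Dist where
  toFun φ := ∫ x, φ x ∂surfaceMeasure r
  map_add' φ ψ := by
    have h (χ : Test) : Integrable χ (surfaceMeasure r) :=
      χ.continuous.integrable_of_hasCompactSupport χ.hasCompactSupport
    simpa using integral_add (h φ) (h ψ)
  map_smul' a φ := by
    simpa using integral_const_mul (μ := surfaceMeasure r) a φ
  cont := by
    have h : LocallyIntegrableOn (fun _ : Space => (1 : ℝ)) ((⊤ : Opens Space) : Set Space)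
        (surfaceMeasure r) := (integrable_const 1).locallyIntegrable.locallyIntegrableOn _
    have hc := (TestFunction.integralAgainstBilinCLM (n := ⊤) (Ω := (⊤ : Opens Space))
      (ContinuousLinearMap.mul ℝ ℝ) (surfaceMeasure r) (fun _ => (1 : ℝ))).continuous
    refine hc.congr fun φ => ?_
    rw [TestFunction.integralAgainstBilinCLM_eq_integral h]
    simp

/-- The Kirchhoff kernel `K(t, x) = δ(|x| - |t|) / (4πt)`; it vanishes for `t = 0`. -/
def K (t : ℝ) : Dist := (4 * Real.pi * t)⁻¹ • deltaSphere |t|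

open Classical in
/-- The derivative in `t` of a family of distributions, in the weak sense. -/
def timeDeriv (T : ℝ → Dist) (t : ℝ) : Dist :=
  if h : ∃ D : Dist, ∀ φ : Test, HasDerivAt (fun τ => T τ φ) (D φ) t then h.choose else 0

/-- The matrix of the operator `rot ∘ T`, i.e. `rot (T * F) = (rot ∘ T) * F`. -/
def rotMat (T : Dist) : Matrix (Fin 3) (Fin 3) Dist :=
  !![0, -∂_{e 2} T, ∂_{e 1} T;
     ∂_{e 2} T, 0, -∂_{e 0} T;
     -∂_{e 1} T, ∂_{e 0} T, 0]

/-- The `6 × 6` matrix distribution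
`M(t) = ((∂ₜK)(ct), rot ∘ K(ct); -rot ∘ K(ct), (∂ₜK)(ct))`. -/
def M (c t : ℝ) : Matrix (Fin 3 ⊕ Fin 3) (Fin 3 ⊕ Fin 3) Dist :=
  Matrix.fromBlocks (Matrix.diagonal fun _ => timeDeriv K (c * t)) (rotMat (K (c * t)))
    (-rotMat (K (c * t))) (Matrix.diagonal fun _ => timeDeriv K (c * t))

/-- The `6 × 4` matrix distribution
`G(t) = c (-∇K(ct), -(∂ₜK)(ct); 0, rot ∘ K(ct))`. -/
def G (c t : ℝ) : Matrix (Fin 3 ⊕ Fin 3) (Unit ⊕ Fin 3) Dist :=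
  c • Matrix.fromBlocks (Matrix.of fun i _ => -∂_{e i} (K (c * t)))
    (-Matrix.diagonal fun _ => timeDeriv K (c * t)) 0 (rotMat (K (c * t)))

/-! ### Convolution -/

/-- The test function `x ↦ φ(x + y)`. -/
def shift (y : Space) (φ : Test) : Test where
  toFun x := φ (x + y)
  contDiff' := φ.contDiff.comp (contDiff_id.add contDiff_const)
  hasCompactSupport' := φ.hasCompactSupport.comp_homeomorph (Homeomorph.addRight y)
  tsupport_subset' := fun _ _ => trivial

/-- `⟨T * f, φ⟩ = ∫ f(y) ⟨T, φ(· + y)⟩ dy`, for a distribution `T` with compact support and a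
locally integrable function `f`. -/
def conv (T : Dist) (f : Space → ℝ) (φ : Test) : ℝ := ∫ y, f y * T (shift y φ)

/-- `⟨(A * f)ᵢ, φ⟩` for a matrix `A` of distributions and a vector `f` of functions. -/
def matConv {m n : Type} [Fintype n] (A : Matrix m n Dist) (f : n → Space → ℝ) (i : m)
    (φ : Test) : ℝ := ∑ k, conv (A i k) (f k) φ

/-- The six-component vector `(E, B)`. -/
def fieldVec (u : L2V × L2V) : Fin 3 ⊕ Fin 3 → Space → ℝ :=
  Sum.elim (fun i x => u.1 x i) (fun i x => u.2 x i)

/-- The four-component vector `(ρ, j / c)`. -/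
def sourceVec (c : ℝ) (ρ : L2) (j : L2V) : Unit ⊕ Fin 3 → Space → ℝ :=
  Sum.elim (fun _ x => ρ x) (fun i x => 1 / c * j x i)

end Maxwell

end

/-!
Integrated against the Kirchhoff kernel, a test function `φ` yields the solution of the wave
equation with initial value `0` and initial velocity `φ`. With one additional scalar component for
each of the two divergence constraints, the Maxwell equations become a system
`∂ₜ V = c ∑ Aᵢ ∂ᵢ V + S` for eight components, whose matrices are symmetric and satisfy the Clifford
relations `Aᵢ Aⱼ + Aⱼ Aᵢ = 2 δᵢⱼ`. Thus `∑ Aᵢ ∂ᵢ` is a square root of the Laplacian, and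
`(∂ₜ K)(ct) * Φ + ∑ Aᵢ ∂ᵢ (K(ct) * Φ)` solves the homogeneous system with initial value `Φ`. By the
symmetry of the `Aᵢ` this flow preserves the `L²` norm of test functions, so it extends to a group
of isometries of `L²`, and Duhamel's formula solves the inhomogeneous problem. Conversely, pairing a
weak solution with the flow of a test function gives a scalar function of time whose distributional
derivative is known, so every weak solution is given by Duhamel's formula. The additional components
of this solution vanish because the divergence constraints hold initially and charge is conserved.
The kernels `M` and `G` involve only `K`, `∂ₜ K` and derivatives of `K`, which live on the sphere
`|x| = c|t|`.
-/

noncomputable section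

namespace Maxwell

open scoped ContDiff

/-! ### Infinitesimal rotations -/

section Rotations

variable {E F : Type*} [NormedAddCommGroup E] [InnerProductSpace ℝ E]
  [NormedAddCommGroup F] [NormedSpace ℝ F]

/-- The generator `y ↦ ⟪u, y⟫ v - ⟪v, y⟫ u` of the rotations in the plane spanned by `u`, `v`. -/
def rotationGenerator (u v : E) : E →L[ℝ] E :=
  InnerProductSpace.rankOne ℝ v u - InnerProductSpace.rankOne ℝ u v

lemma rotationGenerator_apply (u v y : E) :
    rotationGenerator u v y = inner ℝ u y • v - inner ℝ v y • u := by
  simp [rotationGenerator]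

lemma rotationGenerator_mem_skewAdjoint [CompleteSpace E] (u v : E) :
    rotationGenerator u v ∈ skewAdjoint (E →L[ℝ] E) := by
  rw [skewAdjoint.mem_iff, ContinuousLinearMap.star_eq_adjoint, rotationGenerator, map_sub,
    InnerProductSpace.adjoint_rankOne, InnerProductSpace.adjoint_rankOne, neg_sub]

variable {ι : Type*} [Fintype ι] (b : OrthonormalBasis ι ℝ E)

lemma sum_rotationGenerator_sq (y : E) :
    ∑ i, ∑ j, rotationGenerator (b i) (b j) (rotationGenerator (b i) (b j) y) =
      -(2 * (Module.finrank ℝ E - 1) : ℝ) • y := by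
  classical
  have hcoord : ∑ i, inner ℝ (b i) y • b i = y := b.sum_repr' y
  simp only [rotationGenerator_apply, inner_sub_right, inner_smul_right,
    b.inner_eq_ite, sub_smul, mul_ite, mul_one, mul_zero, ite_smul, zero_smul, if_true,
    Finset.sum_sub_distrib, Finset.sum_ite_eq, Finset.sum_ite_eq', Finset.mem_univ,
    Finset.sum_const, Finset.card_univ, ← Finset.smul_sum, hcoord,
    Module.finrank_eq_card_basis b.toBasis, ← Nat.cast_smul_eq_nsmul ℝ]
  module

lemma sum_bilin_rotationGenerator (B : E →L[ℝ] E →L[ℝ] F) (y : E) :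
    ∑ i, ∑ j, B (rotationGenerator (b i) (b j) y) (rotationGenerator (b i) (b j) y) =
      (2 : ℝ) • (‖y‖ ^ 2 • ∑ i, B (b i) (b i) - B y y) := by
  have hcoord : ∑ i, inner ℝ (b i) y • b i = y := b.sum_repr' y
  have hnorm : ∑ i, inner ℝ (b i) y * inner ℝ (b i) y = ‖y‖ ^ 2 := by
    simp [← b.sum_sq_norm_inner_right y, pow_two]
  have hcross : ∑ i, ∑ j, inner ℝ (b i) y • inner ℝ (b j) y • B (b i) (b j) = B y y := by
    conv_rhs => rw [← hcoord]
    simp only [map_sum, map_smul, sum_apply, smul_apply, Finset.smul_sum]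
    rw [Finset.sum_comm]
    exact Finset.sum_congr rfl fun i _ => Finset.sum_congr rfl fun j _ => smul_comm _ _ _
  have hcross' : ∑ i, ∑ j, inner ℝ (b j) y • inner ℝ (b i) y • B (b j) (b i) = B y y := by
    rw [Finset.sum_comm, hcross]
  have hdiag : ∑ i, ∑ j, inner ℝ (b j) y • inner ℝ (b j) y • B (b i) (b i) =
      ‖y‖ ^ 2 • ∑ i, B (b i) (b i) := by
    simp only [smul_smul, ← Finset.sum_smul, hnorm, Finset.smul_sum]
  have hdiag' : ∑ i, ∑ j, inner ℝ (b i) y • inner ℝ (b i) y • B (b j) (b j) =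
      ‖y‖ ^ 2 • ∑ i, B (b i) (b i) := by
    rw [Finset.sum_comm, hdiag]
  simp only [rotationGenerator_apply, map_sub, map_smul, sub_apply, smul_apply, smul_sub,
    Finset.sum_sub_distrib]
  rw [hcross, hcross', hdiag, hdiag']
  module

end Rotations

/-! ### Integration over the unit sphere -/

section Sphere

open scoped Pointwise

variable {E F : Type*} [NormedAddCommGroup E] [InnerProductSpace ℝ E] [FiniteDimensional ℝ E]
  [MeasurableSpace E] [BorelSpace E] [NormedAddCommGroup F]

variable (E) in
/-- Surface measure of the unit sphere of a Euclidean space, as a measure on the whole space. -/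
def sphereMeasure : Measure E := (volume : Measure E).toSphere.map (↑)

instance : IsFiniteMeasure (sphereMeasure E) := by
  unfold sphereMeasure; infer_instance

lemma ae_norm_eq_one_sphereMeasure : ∀ᵐ y ∂sphereMeasure E, ‖y‖ = 1 := by
  rw [sphereMeasure, ae_map_iff measurable_subtype_coe.aemeasurable
    (measurableSet_eq_fun measurable_norm measurable_const)]
  exact .of_forall fun z => by simp

lemma sphereMeasure_apply {s : Set E} (hs : MeasurableSet s) :
    sphereMeasure E s = Module.finrank ℝ E *
      volume (Set.Ioo (0 : ℝ) 1 • (Metric.sphere (0 : E) 1 ∩ s)) := by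
  rw [sphereMeasure, Measure.map_apply measurable_subtype_coe hs,
    Measure.toSphere_apply' _ (measurable_subtype_coe hs), Subtype.image_preimage_coe]

lemma measurePreserving_sphereMeasure (L : E ≃ₗᵢ[ℝ] E) :
    MeasurePreserving L (sphereMeasure E) (sphereMeasure E) where
  measurable := L.continuous.measurable
  map_eq := by
    ext s hs
    have hcone : Set.Ioo (0 : ℝ) 1 • (Metric.sphere (0 : E) 1 ∩ L ⁻¹' s) =
        L ⁻¹' (Set.Ioo (0 : ℝ) 1 • (Metric.sphere (0 : E) 1 ∩ s)) := by
      ext x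
      simp only [Set.mem_smul, Set.mem_inter_iff, Set.mem_preimage, mem_sphere_zero_iff_norm]
      constructor
      · rintro ⟨r, hr, y, ⟨hy, hys⟩, rfl⟩
        exact ⟨r, hr, L y, ⟨by simpa using hy, hys⟩, by simp⟩
      · rintro ⟨r, hr, y, ⟨hy, hys⟩, hx⟩
        refine ⟨r, hr, L.symm y, ⟨by simpa using hy, by simpa using hys⟩, ?_⟩
        rw [← map_smul, hx, L.symm_apply_apply]
    rw [Measure.map_apply L.continuous.measurable hs, sphereMeasure_apply hs,
      sphereMeasure_apply (L.continuous.measurable hs), hcone]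
    congr 1
    exact L.measurePreserving.measure_preimage_equiv (f := L.toHomeomorph.toMeasurableEquiv) _

lemma integral_sphereMeasure_comp [NormedSpace ℝ F] (L : E ≃ₗᵢ[ℝ] E) (f : E → F) :
    ∫ y, f (L y) ∂sphereMeasure E = ∫ y, f y ∂sphereMeasure E :=
  (measurePreserving_sphereMeasure L).integral_comp L.toHomeomorph.measurableEmbedding f

lemma integral_sphereMeasure_neg [NormedSpace ℝ F] (f : E → F) :
    ∫ y, f (-y) ∂sphereMeasure E = ∫ y, f y ∂sphereMeasure E :=
  integral_sphereMeasure_comp (LinearIsometryEquiv.neg ℝ) f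

lemma integrable_sphereMeasure {f : E → F} (hf : Continuous f) :
    Integrable f (sphereMeasure E) := by
  obtain ⟨C, hC⟩ := (isCompact_closedBall (0 : E) 1).exists_bound_of_continuousOn hf.continuousOn
  refine .of_bound hf.aestronglyMeasurable C ?_
  filter_upwards [ae_norm_eq_one_sphereMeasure] with y hy
  exact hC y (by simp [hy])

variable [NormedSpace ℝ F]

lemma hasDerivAt_integral_sphereMeasure {h h' : ℝ → E → F}
    (hd : ∀ t y, HasDerivAt (fun s => h s y) (h' t y) t)
    (hc : ∀ t, Continuous (h t)) (hc' : Continuous fun p : ℝ × E => h' p.1 p.2) (t : ℝ) :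
    HasDerivAt (fun s => ∫ y, h s y ∂sphereMeasure E) (∫ y, h' t y ∂sphereMeasure E) t := by
  obtain ⟨C, hC⟩ := ((isCompact_Icc (a := t - 1) (b := t + 1)).prod
    (isCompact_closedBall (0 : E) 1)).exists_bound_of_continuousOn hc'.continuousOn
  refine (hasDerivAt_integral_of_dominated_loc_of_deriv_le (bound := fun _ => C)
    (Icc_mem_nhds (by linarith : t - 1 < t) (by linarith : t < t + 1))
    (.of_forall fun s => (hc s).aestronglyMeasurable) (integrable_sphereMeasure (hc t))
    (hc'.comp (Continuous.prodMk_right t)).aestronglyMeasurable ?_ (integrable_const C)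
    (.of_forall fun y s _ => hd s y)).2
  filter_upwards [ae_norm_eq_one_sphereMeasure] with y hy s hs
  exact hC (s, y) ⟨hs, by simp [hy]⟩

-- Cut off away from the sphere, the integral is a convolution with `sphereMeasure`, evaluated
-- at the origin, so that Mathlib's smoothness of convolutions with parameters applies.
lemma contDiff_integral_sphereMeasure {P : Type*} [NormedAddCommGroup P] [NormedSpace ℝ P]
    {h : P → E → F} (hh : ContDiff ℝ ∞ fun q : P × E => h q.1 q.2) :
    ContDiff ℝ ∞ fun p => ∫ y, h p y ∂sphereMeasure E := by
  let b : ContDiffBump (0 : E) := ⟨1, 2, one_pos, one_lt_two⟩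
  let g : P → E → F := fun p y => b y • h p (-y)
  have hg : ContDiffOn ℝ ∞ (Function.HasUncurry.uncurry g) (Set.univ ×ˢ Set.univ) :=
    ((b.contDiff.comp contDiff_snd).smul
      (hh.comp (contDiff_fst.prodMk contDiff_snd.neg))).contDiffOn
  have hg_supp (p : P) (x : E) (hx : x ∉ Metric.closedBall (0 : E) 2) : g p x = 0 := by
    have hbx : b x = 0 := b.zero_of_le_dist (le_of_not_ge hx)
    simp [g, hbx]
  have hconv := contDiffOn_convolution_right_with_param_comp (n := ⊤) (μ := sphereMeasure E)
    (ContinuousLinearMap.lsmul ℝ ℝ) (v := fun _ : P => (0 : E)) contDiffOn_const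
    (f := fun _ => (1 : ℝ)) (g := g) isOpen_univ (isCompact_closedBall (0 : E) 2)
    (fun p x _ hx => hg_supp p x hx) (integrable_const 1).locallyIntegrable hg
  rw [contDiffOn_univ] at hconv
  convert hconv using 2 with p
  rw [convolution_def]
  refine integral_congr_ae ?_
  filter_upwards [ae_norm_eq_one_sphereMeasure] with y hy
  have hby : b (-y) = 1 := b.one_of_mem_closedBall (by simp [b, hy])
  simp [g, hby]

-- Differentiate the integral of `f ∘ exp (θ A)`, which does not depend on `θ`.
lemma integral_fderiv_skewAdjoint_sphereMeasure {A : E →L[ℝ] E}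
    (hA : A ∈ skewAdjoint (E →L[ℝ] E)) {f : E → F} (hf : ContDiff ℝ 1 f) :
    ∫ y, fderiv ℝ f y (A y) ∂sphereMeasure E = 0 := by
  let _ : NormedAlgebra ℚ (E →L[ℝ] E) := .restrictScalars ℚ ℝ _
  let R (θ : ℝ) : E ≃ₗᵢ[ℝ] E := Unitary.linearIsometryEquiv
    ⟨NormedSpace.exp (θ • A), NormedSpace.exp_mem_unitary_of_mem_skewAdjoint
      (skewAdjoint.smul_mem θ hA)⟩
  have hR_apply (θ : ℝ) (y : E) : R θ y = NormedSpace.exp (θ • A) y := rfl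
  have hR_deriv (θ : ℝ) (y : E) :
      HasDerivAt (fun s => R s y) ((NormedSpace.exp (θ • A) * A) y) θ := by
    simpa [hR_apply] using (hasDerivAt_exp_smul_const A θ).clm_apply (hasDerivAt_const θ y)
  have hexp : Continuous fun p : ℝ × E => NormedSpace.exp (p.1 • A) :=
    NormedSpace.exp_continuous.comp (by fun_prop)
  have hderiv := hasDerivAt_integral_sphereMeasure
    (fun θ y => ((hf.differentiable one_ne_zero) _).hasFDerivAt.comp_hasDerivAt θ (hR_deriv θ y))
    (fun θ => hf.continuous.comp (R θ).continuous)
    (((hf.continuous_fderiv one_ne_zero).comp (hexp.clm_apply continuous_snd)).clm_apply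
      ((hexp.mul continuous_const).clm_apply continuous_snd)) 0
  have hconst (θ : ℝ) : ∫ y, (f ∘ fun s => R s y) θ ∂sphereMeasure E =
      ∫ y, f y ∂sphereMeasure E := integral_sphereMeasure_comp (R θ) f
  simp only [hconst] at hderiv
  simpa [hR_apply] using hderiv.unique (hasDerivAt_const _ _)

-- Sum the rotational derivatives of `y ↦ α y (A y)` over the generators `A` of the rotations.
lemma integral_divergence_sphereMeasure {ι : Type*} [Fintype ι] (b : OrthonormalBasis ι ℝ E)
    {α : E → E →L[ℝ] F} (hα : ContDiff ℝ 1 α) :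
    ∫ y, ∑ i, fderiv ℝ α y (b i) (b i) ∂sphereMeasure E =
      ∫ y, (fderiv ℝ α y y y + (Module.finrank ℝ E - 1 : ℝ) • α y y) ∂sphereMeasure E := by
  have : Continuous (fderiv ℝ α) := hα.continuous_fderiv one_ne_zero
  have hαc : Continuous α := hα.continuous
  let A (i j : ι) : E →L[ℝ] E := rotationGenerator (b i) (b j)
  have hA (i j : ι) :
      ∫ y, (fderiv ℝ α y (A i j y) (A i j y) + α y (A i j (A i j y))) ∂sphereMeasure E = 0 := by
    have hrot := integral_fderiv_skewAdjoint_sphereMeasure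
      (rotationGenerator_mem_skewAdjoint (b i) (b j)) (f := fun y => α y (A i j y))
      (hα.clm_apply (A i j).contDiff)
    refine Eq.trans (integral_congr_ae (.of_forall fun y => ?_)) hrot
    have hd := (((hα.differentiable one_ne_zero) y).hasFDerivAt.clm_apply
      (A i j).hasFDerivAt).fderiv
    simp [hd, A, add_comm]
  have hint (i j : ι) : Integrable
      (fun y => fderiv ℝ α y (A i j y) (A i j y) + α y (A i j (A i j y))) (sphereMeasure E) :=
    integrable_sphereMeasure (by fun_prop)
  have hsum : ∫ y, (2 : ℝ) • (∑ i, fderiv ℝ α y (b i) (b i) -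
      (fderiv ℝ α y y y + (Module.finrank ℝ E - 1 : ℝ) • α y y)) ∂sphereMeasure E = 0 := by
    calc _ = ∫ y, ∑ i, ∑ j, (fderiv ℝ α y (A i j y) (A i j y) + α y (A i j (A i j y)))
          ∂sphereMeasure E := by
          refine integral_congr_ae ?_
          filter_upwards [ae_norm_eq_one_sphereMeasure] with y hy
          simp only [Finset.sum_add_distrib, A, sum_bilin_rotationGenerator, ← map_sum,
            sum_rotationGenerator_sq, hy, map_smul]
          module
      _ = 0 := by
          rw [integral_finsetSum _ fun i _ => integrable_finsetSum _ fun j _ => hint i j]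
          refine Finset.sum_eq_zero fun i _ => ?_
          rw [integral_finsetSum _ fun j _ => hint i j]
          exact Finset.sum_eq_zero fun j _ => hA i j
  rw [integral_smul, smul_eq_zero_iff_right two_ne_zero, integral_sub
    (integrable_sphereMeasure (by fun_prop)) (integrable_sphereMeasure (by fun_prop))] at hsum
  exact sub_eq_zero.1 hsum

end Sphere

/-! ### Smooth curves of test functions -/

section TestCurves

variable {E : Type*} [NormedAddCommGroup E]

lemma exists_forall_norm_gt_eq_zero {F : Type*} [Zero F] {f : E → F} (hf : HasCompactSupport f) :
    ∃ R : ℝ, ∀ x, R < ‖x‖ → f x = 0 := by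
  obtain ⟨R, hR⟩ := hf.isCompact.isBounded.exists_norm_le
  exact ⟨R, fun x hx => image_eq_zero_of_notMem_tsupport fun h => (hR x h).not_gt hx⟩

variable [NormedSpace ℝ E]

/-- The derivative in the direction `v` of a function of time and space. -/
def pderiv (v : ℝ × E) (F : ℝ → E → ℝ) (t : ℝ) (x : E) : ℝ :=
  fderiv ℝ (fun p : ℝ × E => F p.1 p.2) (t, x) v

/-- The direction of time. -/
abbrev timeDir : ℝ × E := (1, 0)

/-- The direction of the `i`-th coordinate of space. -/
abbrev spaceDir (i : Fin 3) : ℝ × Space := (0, e i)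

/-- Smooth functions of time and space whose supports in space are locally uniformly bounded. -/
structure IsTestCurve (F : ℝ → E → ℝ) : Prop where
  smooth : ContDiff ℝ ∞ fun p : ℝ × E => F p.1 p.2
  bounded : ∀ T : ℝ, ∃ R : ℝ, ∀ t x, |t| ≤ T → R < ‖x‖ → F t x = 0

lemma lineDeriv_test_apply {Ω : Opens E} (φ : 𝓓(Ω, ℝ)) (v x : E) :
    (∂_{v} φ) x = fderiv ℝ φ x v := by
  rw [TestFunction.lineDerivOp_eq_lineDerivCLM ℝ, TestFunction.lineDerivCLM_apply_of_le (by simp)]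
  exact ((φ.contDiff.differentiable (by simp)) x).lineDeriv_eq_fderiv

lemma lineDeriv_lineDeriv_test_apply {Ω : Opens E} (φ : 𝓓(Ω, ℝ)) (v w x : E) :
    (∂_{v} (∂_{w} φ)) x = fderiv ℝ (fderiv ℝ φ) x v w := by
  have hdiff : DifferentiableAt ℝ (fderiv ℝ φ) x :=
    (φ.contDiff.fderiv_right (m := ∞) (by simp)).differentiable (by simp) x
  have hfirst : ⇑(∂_{w} φ : 𝓓(Ω, ℝ)) = fun x => fderiv ℝ φ x w :=
    funext (lineDeriv_test_apply φ w)
  rw [lineDeriv_test_apply, hfirst, fderiv_clm_apply hdiff (differentiableAt_const w)]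
  simp

lemma lineDeriv_test_comm {Ω : Opens E} (φ : 𝓓(Ω, ℝ)) (v w : E) :
    ∂_{v} (∂_{w} φ) = ∂_{w} (∂_{v} φ) := by
  ext x
  rw [lineDeriv_lineDeriv_test_apply, lineDeriv_lineDeriv_test_apply,
    (φ.contDiff.contDiffAt.isSymmSndFDerivAt (by simpa using ENat.LEInfty.out)).eq]

namespace IsTestCurve

variable {F G : ℝ → E → ℝ}

lemma of_test (φ : 𝓓((⊤ : Opens E), ℝ)) : IsTestCurve fun _ x => φ x where
  smooth := φ.contDiff.comp contDiff_snd
  bounded _ := by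
    obtain ⟨R, hR⟩ := exists_forall_norm_gt_eq_zero φ.hasCompactSupport
    exact ⟨R, fun _ x _ hx => hR x hx⟩

lemma of_spaceTime_test (φ : 𝓓((⊤ : Opens (ℝ × E)), ℝ)) : IsTestCurve fun t x => φ (t, x) where
  smooth := φ.contDiff
  bounded _ := by
    obtain ⟨R, hR⟩ := exists_forall_norm_gt_eq_zero φ.hasCompactSupport
    exact ⟨R, fun t x _ hx => hR _ (hx.trans_le (norm_snd_le (t, x)))⟩

lemma differentiableAt (hF : IsTestCurve F) (p : ℝ × E) :
    DifferentiableAt ℝ (fun p : ℝ × E => F p.1 p.2) p :=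
  hF.smooth.differentiable (by simp) p

lemma hasDerivAt_time (hF : IsTestCurve F) (t : ℝ) (x : E) :
    HasDerivAt (fun s => F s x) (pderiv timeDir F t x) t :=
  (hF.differentiableAt (t, x)).hasFDerivAt.comp_hasDerivAt (f := fun s => (s, x)) t
    ((hasDerivAt_id t).prodMk (hasDerivAt_const t x))

lemma pderiv_space (hF : IsTestCurve F) (v : E) (t : ℝ) (x : E) :
    pderiv (0, v) F t x = fderiv ℝ (F t) x v := by
  have h : HasFDerivAt (F t) _ x := (hF.differentiableAt (t, x)).hasFDerivAt.comp x
    ((hasFDerivAt_const t x).prodMk (hasFDerivAt_id x))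
  simp [h.fderiv, pderiv]

lemma contDiff_slice (hF : IsTestCurve F) (t : ℝ) : ContDiff ℝ ∞ (F t) :=
  hF.smooth.comp (contDiff_const.prodMk contDiff_id)

protected lemma pderiv (hF : IsTestCurve F) (v : ℝ × E) : IsTestCurve (pderiv v F) where
  smooth := (hF.smooth.fderiv_right (m := ∞) (by simp)).clm_apply contDiff_const
  bounded T := by
    obtain ⟨R, hR⟩ := hF.bounded (T + 1)
    refine ⟨R, fun t x ht hx => ?_⟩
    have hopen : IsOpen {p : ℝ × E | |p.1| < T + 1 ∧ R < ‖p.2‖} :=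
      (isOpen_lt continuous_fst.abs continuous_const).inter
        (isOpen_lt continuous_const continuous_snd.norm)
    have hzero : (fun p : ℝ × E => F p.1 p.2) =ᶠ[nhds (t, x)] fun _ => 0 := by
      filter_upwards [hopen.mem_nhds ⟨show |t| < T + 1 by linarith, hx⟩] with p hp
      exact hR _ _ hp.1.le hp.2
    simp [pderiv, hzero.fderiv_eq]

lemma pderiv_comm (hF : IsTestCurve F) (v w : ℝ × E) :
    pderiv v (pderiv w F) = pderiv w (pderiv v F) := by
  funext t x
  have hsymm : IsSymmSndFDerivAt ℝ (fun p : ℝ × E => F p.1 p.2) (t, x) :=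
    hF.smooth.contDiffAt.isSymmSndFDerivAt (by simpa using ENat.LEInfty.out)
  have hdiff : DifferentiableAt ℝ (fderiv ℝ fun p : ℝ × E => F p.1 p.2) (t, x) :=
    (hF.smooth.fderiv_right (m := ∞) (by simp)).differentiable (by simp) _
  have hsecond (v w : ℝ × E) : pderiv v (pderiv w F) t x =
      fderiv ℝ (fderiv ℝ fun p : ℝ × E => F p.1 p.2) (t, x) v w := by
    simp [pderiv, fderiv_clm_apply hdiff (differentiableAt_const w)]
  rw [hsecond, hsecond, hsymm.eq]

protected lemma add (hF : IsTestCurve F) (hG : IsTestCurve G) :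
    IsTestCurve fun t x => F t x + G t x where
  smooth := hF.smooth.add hG.smooth
  bounded T := by
    obtain ⟨R, hR⟩ := hF.bounded T
    obtain ⟨R', hR'⟩ := hG.bounded T
    refine ⟨max R R', fun t x ht hx => ?_⟩
    rw [hR t x ht ((le_max_left _ _).trans_lt hx), hR' t x ht ((le_max_right _ _).trans_lt hx),
      add_zero]

protected lemma mul_left (hF : IsTestCurve F) {η : ℝ → ℝ} (hη : ContDiff ℝ ∞ η) :
    IsTestCurve fun t x => η t * F t x where
  smooth := (hη.comp contDiff_fst).mul hF.smooth
  bounded T := by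
    obtain ⟨R, hR⟩ := hF.bounded T
    exact ⟨R, fun t x ht hx => by rw [hR t x ht hx, mul_zero]⟩

protected lemma const_mul (hF : IsTestCurve F) (a : ℝ) : IsTestCurve fun t x => a * F t x :=
  hF.mul_left contDiff_const

protected lemma zero : IsTestCurve fun _ (_ : E) => 0 := ⟨contDiff_const, fun _ => ⟨0, by simp⟩⟩

protected lemma sum {κ : Type*} (s : Finset κ) {F : κ → ℝ → E → ℝ}
    (hF : ∀ k ∈ s, IsTestCurve (F k)) : IsTestCurve fun t x => ∑ k ∈ s, F k t x := by
  classical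
  induction s using Finset.induction_on with
  | empty => simpa using IsTestCurve.zero
  | insert a s ha ih =>
    simp only [Finset.sum_insert ha]
    exact (hF a (by simp)).add (ih fun k hk => hF k (by simp [hk]))

protected lemma comp_affine (hF : IsTestCurve F) (a b : ℝ) :
    IsTestCurve fun t => F (a * t + b) where
  smooth := hF.smooth.comp
    (((contDiff_const.mul contDiff_fst).add contDiff_const).prodMk contDiff_snd)
  bounded T := by
    obtain ⟨R, hR⟩ := hF.bounded (|a| * T + |b|)
    refine ⟨R, fun t x ht hx => hR _ _ ?_ hx⟩
    calc |a * t + b| ≤ |a| * |t| + |b| := (abs_add_le _ _).trans_eq (by rw [abs_mul])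
      _ ≤ |a| * T + |b| := by gcongr

protected lemma comp_mul (hF : IsTestCurve F) (c : ℝ) : IsTestCurve fun t => F (c * t) := by
  simpa using hF.comp_affine c 0

section Calculus

lemma pderiv_add (hF : IsTestCurve F) (hG : IsTestCurve G) (v : ℝ × E) (t : ℝ) (x : E) :
    pderiv v (fun t x => F t x + G t x) t x = pderiv v F t x + pderiv v G t x := by
  simp [pderiv, fderiv_fun_add (hF.differentiableAt _) (hG.differentiableAt _)]

lemma pderiv_const_mul (hF : IsTestCurve F) (a : ℝ) (v : ℝ × E) (t : ℝ) (x : E) :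
    pderiv v (fun t x => a * F t x) t x = a * pderiv v F t x := by
  simp [pderiv, fderiv_const_mul (hF.differentiableAt _)]

lemma pderiv_sum {κ : Type*} (s : Finset κ) {F : κ → ℝ → E → ℝ}
    (hF : ∀ k ∈ s, IsTestCurve (F k)) (v : ℝ × E) (t : ℝ) (x : E) :
    pderiv v (fun t x => ∑ k ∈ s, F k t x) t x = ∑ k ∈ s, pderiv v (F k) t x := by
  simp [pderiv, fderiv_fun_sum fun k hk => (hF k hk).differentiableAt _]

lemma pderiv_space_comp_affine (hF : IsTestCurve F) (v : E) (a b t : ℝ) (x : E) :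
    pderiv (0, v) (fun t => F (a * t + b)) t x = pderiv (0, v) F (a * t + b) x := by
  rw [(hF.comp_affine a b).pderiv_space, hF.pderiv_space]

lemma pderiv_time_comp_affine (hF : IsTestCurve F) (a b t : ℝ) (x : E) :
    pderiv timeDir (fun t => F (a * t + b)) t x = a * pderiv timeDir F (a * t + b) x := by
  have haff : HasDerivAt (fun s => a * s + b) a t := by
    simpa using ((hasDerivAt_id t).const_mul a).add_const b
  exact ((hF.comp_affine a b).hasDerivAt_time t x).unique
    (HasDerivAt.scomp (g₁ := fun s => F s x) t (hF.hasDerivAt_time (a * t + b) x) haff)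

lemma pderiv_space_comp_mul (hF : IsTestCurve F) (v : E) (c t : ℝ) (x : E) :
    pderiv (0, v) (fun t => F (c * t)) t x = pderiv (0, v) F (c * t) x := by
  simpa using hF.pderiv_space_comp_affine v c 0 t x

lemma pderiv_time_comp_mul (hF : IsTestCurve F) (c t : ℝ) (x : E) :
    pderiv timeDir (fun t => F (c * t)) t x = c * pderiv timeDir F (c * t) x := by
  simpa using hF.pderiv_time_comp_affine c 0 t x

end Calculus

variable [ProperSpace E]

lemma hasCompactSupport_slice (hF : IsTestCurve F) (t : ℝ) : HasCompactSupport (F t) := by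
  obtain ⟨R, hR⟩ := hF.bounded |t|
  refine .intro (isCompact_closedBall (0 : E) R) fun x hx => hR t x le_rfl ?_
  simpa using hx

lemma eventually_norm_sub_le (hF : IsTestCurve F) (t : ℝ) {δ : ℝ} (hδ : 0 < δ) :
    ∀ᶠ s in nhds t, ∀ x, ‖F s x - F t x‖ ≤ δ := by
  obtain ⟨R, hR⟩ := hF.bounded (|t| + 1)
  obtain ⟨v, hv, hclose⟩ := (isCompact_closedBall (0 : E) R).mem_uniformity_of_prod
    (f := F) (s := Set.univ) hF.smooth.continuous.continuousOn (Set.mem_univ t)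
    (Metric.dist_mem_uniformity hδ)
  rw [nhdsWithin_univ] at hv
  filter_upwards [hv, Metric.ball_mem_nhds t one_pos] with s hs hst x
  rcases le_or_gt ‖x‖ R with hx | hx
  · exact (hclose s hs x (by simpa using hx)).le
  · have hst' : |s - t| < 1 := hst
    have hs_le : |s| ≤ |t| + 1 := by linarith [abs_sub_abs_le_abs_sub s t]
    rw [hR s x hs_le hx, hR t x (by linarith) hx, sub_zero, norm_zero]
    exact hδ.le

lemma eventually_norm_taylor_le (hF : IsTestCurve F) (t : ℝ) {δ : ℝ} (hδ : 0 < δ) :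
    ∀ᶠ s in nhds t, ∀ x,
      ‖F s x - F t x - (s - t) * pderiv timeDir F t x‖ ≤ δ * ‖s - t‖ := by
  obtain ⟨r, hr, hclose⟩ := Metric.eventually_nhds_iff_ball.1
    ((hF.pderiv timeDir).eventually_norm_sub_le t hδ)
  filter_upwards [Metric.ball_mem_nhds t hr] with s hs x
  have hderiv (τ : ℝ) : HasDerivAt (fun τ => F τ x - (τ - t) * pderiv timeDir F t x)
      (pderiv timeDir F τ x - 1 * pderiv timeDir F t x) τ :=
    (hF.hasDerivAt_time τ x).sub (((hasDerivAt_id τ).sub_const t).mul_const _)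
  have hmean := (convex_ball t r).norm_image_sub_le_of_norm_hasDerivWithin_le
    (fun τ _ => (hderiv τ).hasDerivWithinAt)
    (fun τ hτ => by simpa only [one_mul] using hclose τ hτ x) (Metric.mem_ball_self hr) hs
  simpa [sub_right_comm] using hmean

/-- The test function on space given by a test curve at a fixed time. -/
def slice (hF : IsTestCurve F) (t : ℝ) : 𝓓((⊤ : Opens E), ℝ) where
  toFun := F t
  contDiff' := hF.contDiff_slice t
  hasCompactSupport' := hF.hasCompactSupport_slice t
  tsupport_subset' := fun _ _ => trivial

/-- A smooth function of compact support in time times a test curve, as a test function on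
space-time. -/
def toSpaceTime (hF : IsTestCurve F) {η : ℝ → ℝ} (hη : ContDiff ℝ ∞ η)
    (hη_supp : HasCompactSupport η) : 𝓓((⊤ : Opens (ℝ × E)), ℝ) where
  toFun p := η p.1 * F p.1 p.2
  contDiff' := (hF.mul_left hη).smooth
  hasCompactSupport' := by
    obtain ⟨T, hT⟩ := exists_forall_norm_gt_eq_zero hη_supp
    obtain ⟨R, hR⟩ := hF.bounded T
    refine .intro ((isCompact_closedBall (0 : ℝ) T).prod (isCompact_closedBall (0 : E) R))
      fun p hp => ?_
    rcases le_or_gt ‖p.1‖ T with hpT | hpT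
    · have hpR : R < ‖p.2‖ := by simpa [hpT, -Real.norm_eq_abs] using hp
      rw [hR p.1 p.2 hpT hpR, mul_zero]
    · rw [hT _ hpT, zero_mul]
  tsupport_subset' := fun _ _ => trivial

end IsTestCurve

end TestCurves

/-! ### Test curves in `L²` -/

section SquareIntegrable

variable {α : Type*} [MeasureSpace α]

open Classical in
/-- The class in `L²` of a square integrable function, and `0` for other functions. -/
def toL2 (f : α → ℝ) : Lp ℝ 2 (volume : Measure α) :=
  if h : MemLp f 2 volume then h.toLp f else 0

variable {f g : α → ℝ}

lemma toL2_of_memLp (hf : MemLp f 2 volume) : toL2 f = hf.toLp f := dif_pos hf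

lemma toL2_ae (hf : MemLp f 2 volume) : toL2 f =ᵐ[volume] f := by
  rw [toL2_of_memLp hf]
  exact hf.coeFn_toLp

lemma inner_toL2 (u : Lp ℝ 2 (volume : Measure α)) (hf : MemLp f 2 volume) :
    inner ℝ u (toL2 f) = ∫ x, u x * f x := by
  rw [L2.inner_def]
  refine integral_congr_ae ?_
  filter_upwards [toL2_ae hf] with x hx
  simp [hx, mul_comm]

lemma inner_toL2_toL2 (hf : MemLp f 2 volume) (hg : MemLp g 2 volume) :
    inner ℝ (toL2 f) (toL2 g) = ∫ x, f x * g x := by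
  rw [inner_toL2 _ hg]
  refine integral_congr_ae ?_
  filter_upwards [toL2_ae hf] with x hx
  rw [hx]

lemma toL2_add (hf : MemLp f 2 volume) (hg : MemLp g 2 volume) :
    toL2 (fun x => f x + g x) = toL2 f + toL2 g := by
  rw [toL2_of_memLp hf, toL2_of_memLp hg, ← MemLp.toLp_add hf hg]
  exact toL2_of_memLp (hf.add hg)

lemma toL2_const_mul (hf : MemLp f 2 volume) (a : ℝ) :
    toL2 (fun x => a * f x) = a • toL2 f := by
  rw [toL2_of_memLp hf, ← MemLp.toLp_const_smul a hf]
  exact toL2_of_memLp (hf.const_smul a)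

lemma toL2_sub (hf : MemLp f 2 volume) (hg : MemLp g 2 volume) :
    toL2 (fun x => f x - g x) = toL2 f - toL2 g := by
  rw [toL2_of_memLp hf, toL2_of_memLp hg, ← MemLp.toLp_sub hf hg]
  exact toL2_of_memLp (hf.sub hg)

lemma toL2_zero : toL2 (fun _ : α => 0) = 0 := by
  simpa using toL2_const_mul (f := fun _ : α => (0 : ℝ)) MemLp.zero 0

lemma toL2_sum {κ : Type*} (s : Finset κ) {f : κ → α → ℝ}
    (hf : ∀ k ∈ s, MemLp (f k) 2 volume) :
    toL2 (fun x => ∑ k ∈ s, f k x) = ∑ k ∈ s, toL2 (f k) := by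
  classical
  induction s using Finset.induction_on with
  | empty => simpa using toL2_zero
  | insert a s ha ih =>
    simp only [Finset.sum_insert ha]
    rw [toL2_add (hf a (by simp)) (memLp_finsetSum s fun k hk => hf k (by simp [hk])),
      ih fun k hk => hf k (by simp [hk])]

lemma norm_toL2_le (hf : MemLp f 2 volume) {s : Set α} (hs : volume s < ⊤) {C : ℝ} (hC : 0 ≤ C)
    (hf_supp : ∀ x ∉ s, f x = 0) (hf_le : ∀ x, ‖f x‖ ≤ C) :
    ‖toL2 f‖ ≤ √(volume.real s) * C := by
  refine (pow_le_pow_iff_left₀ (norm_nonneg _) (by positivity) two_ne_zero).1 ?_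
  calc ‖toL2 f‖ ^ 2 = ∫ x in s, f x * f x := by
        rw [← real_inner_self_eq_norm_sq, inner_toL2_toL2 hf hf]
        exact (setIntegral_eq_integral_of_forall_compl_eq_zero fun x hx => by
          rw [hf_supp x hx, zero_mul]).symm
    _ ≤ C ^ 2 * volume.real s := by
        refine (Real.le_norm_self _).trans (norm_setIntegral_le_of_norm_le_const hs fun x _ => ?_)
        rw [norm_mul, ← pow_two]
        exact pow_le_pow_left₀ (norm_nonneg _) (hf_le x) 2
    _ = (√(volume.real s) * C) ^ 2 := by
        rw [mul_pow, Real.sq_sqrt measureReal_nonneg, mul_comm]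

end SquareIntegrable

section TestFunctions

variable {E : Type*} [NormedAddCommGroup E] [NormedSpace ℝ E] [MeasureSpace E]

lemma memLp_test [OpensMeasurableSpace E] [IsFiniteMeasureOnCompacts (volume : Measure E)]
    {Ω : Opens E} (φ : 𝓓(Ω, ℝ)) : MemLp φ 2 volume :=
  φ.continuous.memLp_of_hasCompactSupport φ.hasCompactSupport

variable [FiniteDimensional ℝ E] [BorelSpace E]

lemma inner_toL2_lineDeriv [(volume : Measure E).IsAddHaarMeasure] {Ω : Opens E} (φ ψ : 𝓓(Ω, ℝ))
    (v : E) :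
    inner ℝ (toL2 φ) (toL2 (∂_{v} ψ : 𝓓(Ω, ℝ))) = -inner ℝ (toL2 (∂_{v} φ : 𝓓(Ω, ℝ))) (toL2 ψ) := by
  have hint (φ ψ : 𝓓(Ω, ℝ)) : Integrable (fun x => φ x * ψ x) volume :=
    (φ.continuous.mul ψ.continuous).integrable_of_hasCompactSupport φ.hasCompactSupport.mul_right
  rw [inner_toL2_toL2 (memLp_test _) (memLp_test _), inner_toL2_toL2 (memLp_test _) (memLp_test _)]
  simp only [lineDeriv_test_apply]
  refine integral_mul_fderiv_eq_neg_fderiv_mul_of_integrable ?_ ?_ (hint φ ψ)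
    (fun x _ => φ.contDiff.differentiable (by simp) x)
    (fun x _ => ψ.contDiff.differentiable (by simp) x)
  · simpa only [lineDeriv_test_apply] using hint (∂_{v} φ) ψ
  · simpa only [lineDeriv_test_apply] using hint φ (∂_{v} ψ)

lemma IsTestCurve.inner_toL2_pderiv_space [(volume : Measure E).IsAddHaarMeasure]
    {F G : ℝ → E → ℝ} (hF : IsTestCurve F) (hG : IsTestCurve G) (v : E) (t : ℝ) :
    inner ℝ (toL2 (F t)) (toL2 (pderiv (0, v) G t)) =
      -inner ℝ (toL2 (pderiv (0, v) F t)) (toL2 (G t)) := by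
  have hslice {F : ℝ → E → ℝ} (hF : IsTestCurve F) :
      pderiv (0, v) F t = (∂_{v} (hF.slice t) : 𝓓((⊤ : Opens E), ℝ)) := by
    funext x
    rw [hF.pderiv_space, lineDeriv_test_apply]
    rfl
  rw [hslice hF, hslice hG]
  exact inner_toL2_lineDeriv (hF.slice t) (hG.slice t) v

variable [IsFiniteMeasureOnCompacts (volume : Measure E)]

lemma eq_zero_of_inner_test_eq_zero {u : Lp ℝ 2 (volume : Measure E)}
    (h : ∀ φ : 𝓓((⊤ : Opens E), ℝ), inner ℝ u (toL2 φ) = 0) : u = 0 := by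
  rw [Lp.eq_zero_iff_ae_eq_zero]
  refine ae_eq_zero_of_integral_contDiff_smul_eq_zero
    ((Lp.memLp u).locallyIntegrable (by norm_num)) fun g hg hg_supp => ?_
  rw [← h ⟨g, hg, hg_supp, fun _ _ => trivial⟩, inner_toL2 _ (memLp_test _)]
  exact integral_congr_ae (.of_forall fun x => mul_comm _ _)

namespace IsTestCurve

variable {F : ℝ → E → ℝ}

lemma memLp (hF : IsTestCurve F) (t : ℝ) : MemLp (F t) 2 volume :=
  memLp_test (hF.slice t)

lemma hasDerivAt_toL2 (hF : IsTestCurve F) (t : ℝ) :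
    HasDerivAt (fun s => toL2 (F s)) (toL2 (pderiv timeDir F t)) t := by
  have hF' := hF.pderiv timeDir
  obtain ⟨R, hR⟩ := hF.bounded (|t| + 1)
  obtain ⟨R', hR'⟩ := hF'.bounded (|t| + 1)
  set V := √((volume : Measure E).real (Metric.closedBall 0 (max R R')))
  have : 0 ≤ V := Real.sqrt_nonneg _
  rw [hasDerivAt_iff_isLittleO, Asymptotics.isLittleO_iff]
  intro ε hε
  have hδ : 0 < ε / (V + 1) := by positivity
  filter_upwards [hF.eventually_norm_taylor_le t hδ, Metric.ball_mem_nhds t one_pos] with s hs hst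
  have hst' : |s - t| < 1 := hst
  have hs_le : |s| ≤ |t| + 1 := by linarith [abs_sub_abs_le_abs_sub s t]
  have hsupp (x : E) (hx : x ∉ Metric.closedBall 0 (max R R')) :
      F s x - F t x - (s - t) * pderiv timeDir F t x = 0 := by
    have hx' : max R R' < ‖x‖ := by simpa using hx
    have hxR := (le_max_left _ _).trans_lt hx'
    rw [hR s x hs_le hxR, hR t x (by linarith) hxR,
      hR' t x (by linarith) ((le_max_right _ _).trans_lt hx'), sub_zero, mul_zero, sub_zero]
  have hsub : MemLp (fun x => F s x - F t x) 2 volume := (hF.memLp s).sub (hF.memLp t)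
  have hmul := (hF'.memLp t).const_mul (s - t)
  rw [← toL2_const_mul (hF'.memLp t), ← toL2_sub (hF.memLp s) (hF.memLp t), ← toL2_sub hsub hmul]
  calc _ ≤ V * (ε / (V + 1) * ‖s - t‖) :=
        norm_toL2_le (hsub.sub hmul) measure_closedBall_lt_top (by positivity) hsupp hs
    _ = V / (V + 1) * (ε * ‖s - t‖) := by ring
    _ ≤ ε * ‖s - t‖ := mul_le_of_le_one_left (by positivity)
        ((div_le_one (by positivity)).2 (by linarith))

lemma continuous_toL2 (hF : IsTestCurve F) : Continuous fun t => toL2 (F t) :=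
  continuous_iff_continuousAt.2 fun t => (hF.hasDerivAt_toL2 t).continuousAt

end IsTestCurve

end TestFunctions

/-! ### Spherical means and the wave equation -/

lemma hasDerivAt_comp_add_smul {E F : Type*} [NormedAddCommGroup E] [NormedSpace ℝ E]
    [NormedAddCommGroup F] [NormedSpace ℝ F] {f : E → F} (hf : Differentiable ℝ f) (x v : E)
    (t : ℝ) : HasDerivAt (fun s : ℝ => f (x + s • v)) (fderiv ℝ f (x + t • v) v) t := by
  have hline : HasDerivAt (fun s : ℝ => x + s • v) v t := by
    simpa using ((hasDerivAt_id t).smul_const v).const_add x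
  exact (hf _).hasFDerivAt.comp_hasDerivAt t hline

section SphericalMeans

variable {E F : Type*} [NormedAddCommGroup E] [InnerProductSpace ℝ E] [FiniteDimensional ℝ E]
  [MeasurableSpace E] [BorelSpace E] [NormedAddCommGroup F] [NormedSpace ℝ F] {f : E → F}

lemma hasDerivAt_sphericalMean (hf : ContDiff ℝ 1 f) (x : E) (t : ℝ) :
    HasDerivAt (fun s => ∫ y, f (x + s • y) ∂sphereMeasure E)
      (∫ y, fderiv ℝ f (x + t • y) y ∂sphereMeasure E) t := by
  have : Continuous (fderiv ℝ f) := hf.continuous_fderiv one_ne_zero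
  have hfc := hf.continuous
  exact hasDerivAt_integral_sphereMeasure
    (fun s y => hasDerivAt_comp_add_smul (hf.differentiable one_ne_zero) x y s)
    (fun s => by fun_prop) (by fun_prop) t

lemma hasDerivAt_radial_sphericalMean (hf : ContDiff ℝ 2 f) (x : E) (t : ℝ) :
    HasDerivAt (fun s => ∫ y, fderiv ℝ f (x + s • y) y ∂sphereMeasure E)
      (∫ y, fderiv ℝ (fderiv ℝ f) (x + t • y) y y ∂sphereMeasure E) t := by
  have hf' : ContDiff ℝ 1 (fderiv ℝ f) := hf.fderiv_right (by norm_num)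
  have hf'c := hf'.continuous
  have : Continuous (fderiv ℝ (fderiv ℝ f)) := hf'.continuous_fderiv one_ne_zero
  refine hasDerivAt_integral_sphereMeasure (h := fun s y => fderiv ℝ f (x + s • y) y)
    (h' := fun s y => fderiv ℝ (fderiv ℝ f) (x + s • y) y y) (fun s y => ?_)
    (fun s => by fun_prop) (by fun_prop) t
  simpa using (hasDerivAt_comp_add_smul (hf'.differentiable one_ne_zero) x y s).clm_apply
    (hasDerivAt_const s y)

lemma integral_laplacian_sphereMeasure {ι : Type*} [Fintype ι] (b : OrthonormalBasis ι ℝ E)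
    (hf : ContDiff ℝ 2 f) (x : E) (t : ℝ) :
    t • ∑ i, ∫ y, fderiv ℝ (fderiv ℝ f) (x + t • y) (b i) (b i) ∂sphereMeasure E =
      t • ∫ y, fderiv ℝ (fderiv ℝ f) (x + t • y) y y ∂sphereMeasure E +
        (Module.finrank ℝ E - 1 : ℝ) • ∫ y, fderiv ℝ f (x + t • y) y ∂sphereMeasure E := by
  have hf' : ContDiff ℝ 1 (fderiv ℝ f) := hf.fderiv_right (by norm_num)
  have hf'c := hf'.continuous
  have : Continuous (fderiv ℝ (fderiv ℝ f)) := hf'.continuous_fderiv one_ne_zero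
  have hα : ContDiff ℝ 1 fun y => fderiv ℝ f (x + t • y) :=
    hf'.comp (contDiff_const.add (contDiff_id.const_smul t))
  have hα' (y : E) : fderiv ℝ (fun y => fderiv ℝ f (x + t • y)) y =
      t • fderiv ℝ (fderiv ℝ f) (x + t • y) := by
    have hline : HasFDerivAt (fun y : E => x + t • y) (t • ContinuousLinearMap.id ℝ E) y :=
      ((hasFDerivAt_id y).const_smul t).const_add x
    have hcomp : HasFDerivAt (fun y => fderiv ℝ f (x + t • y)) _ y :=
      (hf'.differentiable one_ne_zero _).hasFDerivAt.comp y hline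
    ext v
    simp [hcomp.fderiv]
  have hdiv := integral_divergence_sphereMeasure b hα
  simp only [hα', smul_apply, ← Finset.smul_sum] at hdiv
  rwa [integral_smul, integral_finsetSum _ fun i _ => integrable_sphereMeasure (by fun_prop),
    integral_add (integrable_sphereMeasure (by fun_prop)) (integrable_sphereMeasure (by fun_prop)),
    integral_smul, integral_smul] at hdiv

end SphericalMeans

/-- The solution of the wave equation on `ℝ × ℝ³` with initial data `0` and `ψ`, given by
Kirchhoff's formula. -/
def kirchhoff (ψ : Test) (t : ℝ) (x : Space) : ℝ :=
  t / (4 * Real.pi) * ∫ y, ψ (x + t • y) ∂sphereMeasure Space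

lemma continuous_comp_add_smul (ψ : Test) (t : ℝ) (x : Space) :
    Continuous fun y => ψ (x + t • y) := ψ.continuous.comp (by fun_prop)

lemma isTestCurve_kirchhoff (ψ : Test) : IsTestCurve (kirchhoff ψ) where
  smooth := (contDiff_fst.div_const _).mul <| contDiff_integral_sphereMeasure
    (ψ.contDiff.comp (contDiff_fst.snd.add (contDiff_fst.fst.smul contDiff_snd)))
  bounded T := by
    obtain ⟨R, hR⟩ := exists_forall_norm_gt_eq_zero ψ.hasCompactSupport
    refine ⟨R + T, fun t x ht hx => mul_eq_zero_of_right _ (integral_eq_zero_of_ae ?_)⟩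
    filter_upwards [ae_norm_eq_one_sphereMeasure] with y hy
    have htriangle := norm_sub_le (x + t • y) (t • y)
    rw [add_sub_cancel_right, norm_smul, hy, mul_one, Real.norm_eq_abs] at htriangle
    exact hR _ (by linarith)

lemma contDiff_test {n : ℕ} (ψ : Test) : ContDiff ℝ n ψ :=
  ψ.contDiff.of_le (mod_cast le_top)

lemma pderiv_time_kirchhoff (ψ : Test) (t : ℝ) (x : Space) :
    pderiv timeDir (kirchhoff ψ) t x =
      1 / (4 * Real.pi) * ∫ y, ψ (x + t • y) ∂sphereMeasure Space +
        t / (4 * Real.pi) * ∫ y, fderiv ℝ ψ (x + t • y) y ∂sphereMeasure Space :=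
  ((isTestCurve_kirchhoff ψ).hasDerivAt_time t x).unique
    (((hasDerivAt_id t).div_const (4 * Real.pi)).mul
      (hasDerivAt_sphericalMean (contDiff_test ψ) x t))

lemma pderiv_time_time_kirchhoff (ψ : Test) :
    pderiv timeDir (pderiv timeDir (kirchhoff ψ)) =
      fun t x => ∑ i, kirchhoff (∂_{e i} (∂_{e i} ψ)) t x := by
  funext t x
  have hderiv := ((isTestCurve_kirchhoff ψ).pderiv timeDir).hasDerivAt_time t x
  simp only [pderiv_time_kirchhoff] at hderiv
  rw [hderiv.unique (((hasDerivAt_sphericalMean (contDiff_test ψ) x t).const_mul _).add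
    (((hasDerivAt_id t).div_const _).mul
      (hasDerivAt_radial_sphericalMean (contDiff_test ψ) x t)))]
  have hlap := integral_laplacian_sphereMeasure (EuclideanSpace.basisFun (Fin 3) ℝ)
    (contDiff_test ψ) x t
  simp only [EuclideanSpace.basisFun_apply, finrank_euclideanSpace_fin, smul_eq_mul] at hlap
  simp only [kirchhoff, lineDeriv_lineDeriv_test_apply, ← Finset.mul_sum, id]
  linear_combination -1 / (4 * Real.pi) * hlap

lemma pderiv_space_kirchhoff (ψ : Test) (v : Space) :
    pderiv (0, v) (kirchhoff ψ) = kirchhoff (∂_{v} ψ) := by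
  funext t x
  have hψ : Differentiable ℝ ψ := ψ.contDiff.differentiable (by simp)
  have hmean := hasDerivAt_integral_sphereMeasure
    (h := fun s y => ψ (x + s • v + t • y)) (h' := fun s y => (∂_{v} ψ) (x + s • v + t • y))
    (fun s y => by
      simpa only [lineDeriv_test_apply, add_right_comm]
        using hasDerivAt_comp_add_smul hψ (x + t • y) v s)
    (fun s => continuous_comp_add_smul ψ t _) ((∂_{v} ψ).continuous.comp (by fun_prop)) 0
  have hline := hasDerivAt_comp_add_smul
    (((isTestCurve_kirchhoff ψ).contDiff_slice t).differentiable (by simp)) x v 0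
  rw [(isTestCurve_kirchhoff ψ).pderiv_space]
  simpa [kirchhoff] using hline.unique (hmean.const_mul (t / (4 * Real.pi)))

lemma kirchhoff_neg (ψ : Test) (t : ℝ) (x : Space) : kirchhoff ψ (-t) x = -kirchhoff ψ t x := by
  have hmean := integral_sphereMeasure_neg fun y => ψ (x + t • y)
  simp only [smul_neg] at hmean
  simp only [kirchhoff, neg_smul, hmean]
  ring

lemma kirchhoff_zero (ψ : Test) (x : Space) : kirchhoff ψ 0 x = 0 := by
  simp [kirchhoff]

lemma pderiv_time_kirchhoff_neg (ψ : Test) (t : ℝ) (x : Space) :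
    pderiv timeDir (kirchhoff ψ) (-t) x = pderiv timeDir (kirchhoff ψ) t x := by
  have hK := isTestCurve_kirchhoff ψ
  have hneg := (hK.hasDerivAt_time (-t) x).scomp t (hasDerivAt_neg t)
  have hodd : (fun s => kirchhoff ψ s x) ∘ Neg.neg = fun s => -kirchhoff ψ s x :=
    funext fun s => kirchhoff_neg ψ s x
  rw [hodd] at hneg
  simpa using hneg.unique (hK.hasDerivAt_time t x).neg

lemma sphereMeasure_real_univ_space : (sphereMeasure Space).real Set.univ = 4 * Real.pi := by
  have hball : 0 ≤ Real.pi * 4 / 3 := by positivity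
  rw [sphereMeasure, Measure.real, Measure.map_apply measurable_subtype_coe MeasurableSet.univ,
    Set.preimage_univ, Measure.toSphere_apply_univ, EuclideanSpace.volume_ball_fin_three]
  simp only [finrank_euclideanSpace_fin, ENNReal.ofReal_one, one_pow, one_mul, ENNReal.toReal_mul,
    ENNReal.toReal_natCast, ENNReal.toReal_ofReal hball]
  ring

lemma pderiv_time_kirchhoff_zero (ψ : Test) (x : Space) :
    pderiv timeDir (kirchhoff ψ) 0 x = ψ x := by
  simp only [pderiv_time_kirchhoff, zero_smul, add_zero, integral_const,
    sphereMeasure_real_univ_space, smul_eq_mul, zero_div, zero_mul]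
  field_simp

lemma kirchhoff_add (φ ψ : Test) (t : ℝ) (x : Space) :
    kirchhoff (φ + ψ) t x = kirchhoff φ t x + kirchhoff ψ t x := by
  simp only [kirchhoff, add_apply]
  rw [integral_add (integrable_sphereMeasure (continuous_comp_add_smul φ t x))
    (integrable_sphereMeasure (continuous_comp_add_smul ψ t x)), mul_add]

lemma kirchhoff_smul (a : ℝ) (ψ : Test) (t : ℝ) (x : Space) :
    kirchhoff (a • ψ) t x = a * kirchhoff ψ t x := by
  simp only [kirchhoff, smul_apply, smul_eq_mul, integral_const_mul]
  ring

/-! ### Symmetric first order systems whose square is the wave equation -/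

section Clifford

open scoped Matrix

variable {κ ι : Type*} [DecidableEq κ] [Fintype ι] [DecidableEq ι] {A : κ → Matrix ι ι ℝ}

/-- Symmetric matrices satisfying the Clifford relations, i.e. those for which the square of
`∑ Aᵢ ∂ᵢ` is the Laplacian. -/
structure IsClifford (A : κ → Matrix ι ι ℝ) : Prop where
  symm : ∀ i, (A i).IsSymm
  anticomm : ∀ i j, A i * A j + A j * A i = if i = j then 2 else 0

lemma IsClifford.sum_mulVec_sum_mulVec [Fintype κ] (hA : IsClifford A) {T : κ → κ → ι → ℝ}
    (hT : ∀ i j, T i j = T j i) : ∑ i, A i *ᵥ ∑ j, A j *ᵥ T i j = ∑ i, T i i := by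
  have hswap : ∑ i, ∑ j, (A i * A j) *ᵥ T i j = ∑ i, ∑ j, (A j * A i) *ᵥ T i j := by
    rw [Finset.sum_comm]
    exact Finset.sum_congr rfl fun i _ => Finset.sum_congr rfl fun j _ => by rw [hT]
  have hdouble : ∑ i, ∑ j, (A i * A j + A j * A i) *ᵥ T i j = (2 : ℝ) • ∑ i, T i i := by
    have hterm (i j : κ) :
        (A i * A j + A j * A i) *ᵥ T i j = if i = j then (2 : ℝ) • T i j else 0 := by
      rw [hA.anticomm]
      split_ifs
      · rw [two_smul, ← one_add_one_eq_two, Matrix.add_mulVec, Matrix.one_mulVec]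
      · exact Matrix.zero_mulVec _
    simp [hterm, Finset.smul_sum]
  simp only [Matrix.add_mulVec, Finset.sum_add_distrib, ← hswap, ← two_smul ℝ] at hdouble
  simp only [Matrix.mulVec_sum, Matrix.mulVec_mulVec]
  exact smul_right_injective _ two_ne_zero hdouble

end Clifford

section Flow

variable {ι : Type*} [Fintype ι] {A : Fin 3 → Matrix ι ι ℝ}

/-- The operator `∑ Aᵢ ∂ᵢ`. -/
def dirac (A : Fin 3 → Matrix ι ι ℝ) (F : ι → ℝ → Space → ℝ) (k : ι) (t : ℝ) (x : Space) : ℝ :=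
  ∑ i, ∑ l, A i k l * pderiv (spaceDir i) (F l) t x

/-- The classical solution of `∂ₜ F = c ∑ Aᵢ ∂ᵢ F` with the initial value `Φ`: the operator
`∂ₜ + c ∑ Aᵢ ∂ᵢ` maps solutions of the wave equation to solutions of the first order system. -/
def flow (A : Fin 3 → Matrix ι ι ℝ) (c : ℝ) (Φ : ι → Test) (k : ι) (t : ℝ) (x : Space) : ℝ :=
  pderiv timeDir (kirchhoff (Φ k)) (c * t) x +
    ∑ i, ∑ l, A i k l * kirchhoff (∂_{e i} (Φ l)) (c * t) x

lemma isTestCurve_dirac {F : ι → ℝ → Space → ℝ} (hF : ∀ k, IsTestCurve (F k)) (k : ι) :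
    IsTestCurve (dirac A F k) :=
  .sum _ fun _ _ => .sum _ fun l _ => ((hF l).pderiv _).const_mul _

lemma isTestCurve_flow (c : ℝ) (Φ : ι → Test) (k : ι) : IsTestCurve (flow A c Φ k) :=
  (((isTestCurve_kirchhoff (Φ k)).pderiv timeDir).comp_mul c).add
    (.sum _ fun _ _ => .sum _ fun _ _ => ((isTestCurve_kirchhoff _).comp_mul c).const_mul _)

lemma flow_zero (c : ℝ) (Φ : ι → Test) (k : ι) : flow A c Φ k 0 = Φ k := by
  funext x
  simp [flow, kirchhoff_zero, pderiv_time_kirchhoff_zero]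

lemma flow_add (c : ℝ) (Φ Ψ : ι → Test) (k : ι) (t : ℝ) (x : Space) :
    flow A c (Φ + Ψ) k t x = flow A c Φ k t x + flow A c Ψ k t x := by
  have hadd (φ ψ : Test) : kirchhoff (φ + ψ) = fun t x => kirchhoff φ t x + kirchhoff ψ t x :=
    funext₂ (kirchhoff_add φ ψ)
  simp only [flow, Pi.add_apply, LineDeriv.lineDerivOp_add, hadd,
    (isTestCurve_kirchhoff _).pderiv_add (isTestCurve_kirchhoff _), mul_add,
    Finset.sum_add_distrib]
  ring

lemma flow_smul (c a : ℝ) (Φ : ι → Test) (k : ι) (t : ℝ) (x : Space) :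
    flow A c (a • Φ) k t x = a * flow A c Φ k t x := by
  have hsmul (φ : Test) : kirchhoff (a • φ) = fun t x => a * kirchhoff φ t x :=
    funext₂ (kirchhoff_smul a φ)
  simp only [flow, Pi.smul_apply, LineDeriv.lineDerivOp_smul, hsmul,
    (isTestCurve_kirchhoff _).pderiv_const_mul, mul_add, Finset.mul_sum, mul_left_comm a]

lemma pderiv_flow (c : ℝ) (Φ : ι → Test) (v : ℝ × Space) (k : ι) (t : ℝ) (x : Space) :
    pderiv v (flow A c Φ k) t x =
      pderiv v (fun t => pderiv timeDir (kirchhoff (Φ k)) (c * t)) t x +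
        ∑ i, ∑ l, A i k l * pderiv v (fun t => kirchhoff (∂_{e i} (Φ l)) (c * t)) t x := by
  have hK (i : Fin 3) (l : ι) := (isTestCurve_kirchhoff (∂_{e i} (Φ l))).comp_mul c
  have hsum (i : Fin 3) : IsTestCurve fun t x =>
      ∑ l, A i k l * kirchhoff (∂_{e i} (Φ l)) (c * t) x :=
    .sum _ fun l _ => (hK i l).const_mul _
  unfold flow
  rw [(((isTestCurve_kirchhoff (Φ k)).pderiv timeDir).comp_mul c).pderiv_add
    (.sum _ fun i _ => hsum i), IsTestCurve.pderiv_sum _ fun i _ => hsum i]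
  simp only [IsTestCurve.pderiv_sum _ fun l _ => (hK _ l).const_mul _,
    (hK _ _).pderiv_const_mul]

variable [DecidableEq ι]

lemma pderiv_time_flow (hA : IsClifford A) (c : ℝ) (Φ : ι → Test) (k : ι) :
    pderiv timeDir (flow A c Φ k) = fun t x => c * dirac A (flow A c Φ) k t x := by
  funext t x
  have hspace (i : Fin 3) (l : ι) : pderiv (spaceDir i) (flow A c Φ l) t x =
      pderiv timeDir (kirchhoff (∂_{e i} (Φ l))) (c * t) x +
        ∑ j, ∑ m, A j l m * kirchhoff (∂_{e i} (∂_{e j} (Φ m))) (c * t) x := by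
    rw [pderiv_flow, ((isTestCurve_kirchhoff _).pderiv _).pderiv_space_comp_mul,
      (isTestCurve_kirchhoff _).pderiv_comm, pderiv_space_kirchhoff]
    simp only [(isTestCurve_kirchhoff _).pderiv_space_comp_mul, pderiv_space_kirchhoff]
  have hsquare := congrFun (hA.sum_mulVec_sum_mulVec
    (T := fun i j m => kirchhoff (∂_{e i} (∂_{e j} (Φ m))) (c * t) x)
    fun i j => funext fun m => by rw [lineDeriv_test_comm]) k
  simp only [Finset.sum_apply, Matrix.mulVec, dotProduct] at hsquare
  simp only [pderiv_flow, dirac, hspace, (isTestCurve_kirchhoff _).pderiv_time_comp_mul,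
    ((isTestCurve_kirchhoff _).pderiv _).pderiv_time_comp_mul, pderiv_time_time_kirchhoff,
    mul_add, Finset.sum_add_distrib, hsquare]
  simp only [Finset.mul_sum]
  rw [add_comm]
  congr! 3
  ring

end Flow

/-! ### The unitary group -/

lemma extendOfNorm_apply_of_norm_eq {X E F : Type*} [AddCommGroup X] [Module ℝ X]
    [NormedAddCommGroup E] [NormedSpace ℝ E] [NormedAddCommGroup F] [NormedSpace ℝ F]
    [CompleteSpace F] {f : X →ₗ[ℝ] F} {g : X →ₗ[ℝ] E} (hg : DenseRange g)
    (h : ∀ x, ‖f x‖ = ‖g x‖) (x : X) : f.extendOfNorm g (g x) = f x :=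
  LinearMap.extendOfNorm_eq hg ⟨1, fun x => by rw [h, one_mul]⟩ x

section Propagator

variable {ι : Type*}

/-- Tuples of square integrable functions. -/
abbrev L2Tuple (ι : Type*) : Type _ := PiLp 2 fun _ : ι => L2

/-- The class in `L²` of a tuple of square integrable functions. -/
def tupleL2 (f : ι → Space → ℝ) : L2Tuple ι := WithLp.toLp 2 fun k => toL2 (f k)

lemma continuous_tuple_apply {V : ℝ → L2Tuple ι} (hV : Continuous V) (k : ι) :
    Continuous fun t => V t k :=
  (PiLp.continuous_apply 2 (fun _ : ι => L2) k).comp hV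

lemma continuous_tupleL2 {F : ι → ℝ → Space → ℝ} (hF : ∀ k, IsTestCurve (F k)) :
    Continuous fun s => tupleL2 fun k => F k s :=
  (PiLp.continuous_toLp 2 _).comp <| continuous_pi fun k =>
    continuous_iff_continuousAt.2 fun t => ((hF k).hasDerivAt_toL2 t).continuousAt

lemma tupleL2_const_mul {f : ι → Space → ℝ} (hf : ∀ k, MemLp (f k) 2 volume) (a : ℝ) :
    (tupleL2 fun k x => a * f k x) = a • tupleL2 f := by
  ext1 k
  exact toL2_const_mul (hf k) a

/-- Tuples of test functions as tuples of square integrable functions. -/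
def testTuple : (ι → Test) →ₗ[ℝ] L2Tuple ι where
  toFun Φ := tupleL2 fun k => Φ k
  map_add' Φ Ψ := by
    ext1 k
    exact toL2_add (memLp_test (Φ k)) (memLp_test (Ψ k))
  map_smul' a Φ := by
    ext1 k
    exact toL2_const_mul (memLp_test (Φ k)) a

lemma testTuple_apply (Φ : ι → Test) : testTuple Φ = tupleL2 fun k => Φ k := rfl

variable [Fintype ι]

lemma inner_tupleL2 (u : L2Tuple ι) (f : ι → Space → ℝ) :
    inner ℝ u (tupleL2 f) = ∑ k, inner ℝ (u k) (toL2 (f k)) :=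
  PiLp.inner_apply _ _

lemma hasDerivAt_tupleL2 {F : ι → ℝ → Space → ℝ} (hF : ∀ k, IsTestCurve (F k)) (t : ℝ) :
    HasDerivAt (fun s => tupleL2 fun k => F k s) (tupleL2 fun k => pderiv timeDir (F k) t) t :=
  ((PiLp.continuousLinearEquiv 2 ℝ fun _ : ι => L2).symm :
    (ι → L2) →L[ℝ] L2Tuple ι).hasFDerivAt.comp_hasDerivAt t
      (hasDerivAt_pi.2 fun k => (hF k).hasDerivAt_toL2 t)

lemma inner_testTuple_single [DecidableEq ι] (u : L2Tuple ι) (k : ι) (φ : Test) :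
    inner ℝ u (testTuple (Pi.single k φ)) = inner ℝ (u k) (toL2 φ) := by
  rw [testTuple_apply, inner_tupleL2, Finset.sum_eq_single k _ (by simp), Pi.single_eq_same]
  intro l _ hl
  have hzero : ⇑((Pi.single k φ : ι → Test) l) = fun _ => (0 : ℝ) := by
    rw [Pi.single_eq_of_ne hl]
    rfl
  rw [hzero, toL2_zero, inner_zero_right]

lemma ext_inner_testTuple {u v : L2Tuple ι}
    (h : ∀ Φ, inner ℝ u (testTuple Φ) = inner ℝ v (testTuple Φ)) : u = v := by
  classical
  rw [← sub_eq_zero]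
  ext1 k
  refine eq_zero_of_inner_test_eq_zero fun φ => ?_
  rw [← inner_testTuple_single, inner_sub_left, h, sub_self]

lemma denseRange_testTuple {ι : Type*} [Finite ι] :
    DenseRange (testTuple : (ι → Test) →ₗ[ℝ] L2Tuple ι) := by
  have := Fintype.ofFinite ι
  have hclosure : (LinearMap.range (testTuple (ι := ι))).topologicalClosure = ⊤ := by
    rw [Submodule.topologicalClosure_eq_top_iff, Submodule.eq_bot_iff]
    intro v hv
    refine ext_inner_testTuple fun Φ => ?_
    rw [inner_zero_left, real_inner_comm]
    exact hv _ (LinearMap.mem_range_self _ _)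
  exact Submodule.dense_iff_topologicalClosure_eq_top.2 hclosure

variable {A : Fin 3 → Matrix ι ι ℝ}

lemma toL2_dirac {F : ι → ℝ → Space → ℝ} (hF : ∀ k, IsTestCurve (F k)) (k : ι) (t : ℝ) :
    toL2 (dirac A F k t) = ∑ i, ∑ l, A i k l • toL2 (pderiv (spaceDir i) (F l) t) := by
  have hmem (i : Fin 3) (l : ι) : MemLp (pderiv (spaceDir i) (F l) t) 2 volume :=
    ((hF l).pderiv _).memLp t
  unfold dirac
  rw [toL2_sum _ fun i _ => memLp_finsetSum _ fun l _ => (hmem i l).const_mul _]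
  simp only [toL2_sum _ fun l _ => (hmem _ l).const_mul _, toL2_const_mul (hmem _ _)]

lemma inner_tupleL2_dirac (hA : ∀ i, (A i).IsSymm) {F G : ι → ℝ → Space → ℝ}
    (hF : ∀ k, IsTestCurve (F k)) (hG : ∀ k, IsTestCurve (G k)) (t : ℝ) :
    inner ℝ (tupleL2 fun k => F k t) (tupleL2 fun k => dirac A G k t) =
      -inner ℝ (tupleL2 fun k => dirac A F k t) (tupleL2 fun k => G k t) := by
  simp only [tupleL2, PiLp.inner_apply, toL2_dirac hF, toL2_dirac hG, inner_sum, sum_inner,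
    inner_smul_left, inner_smul_right, (hF _).inner_toL2_pderiv_space (hG _),
    RCLike.conj_to_real, mul_neg, Finset.sum_neg_distrib]
  congr 1
  calc ∑ k, ∑ i, ∑ l, A i k l * inner ℝ (toL2 (pderiv (spaceDir i) (F k) t)) (toL2 (G l t))
      = ∑ k, ∑ l, ∑ i, A i l k *
          inner ℝ (toL2 (pderiv (spaceDir i) (F k) t)) (toL2 (G l t)) := by
        refine Finset.sum_congr rfl fun k _ => ?_
        rw [Finset.sum_comm]
        simp only [(hA _).apply]
    _ = ∑ l, ∑ i, ∑ k, A i l k *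
          inner ℝ (toL2 (pderiv (spaceDir i) (F k) t)) (toL2 (G l t)) := by
        rw [Finset.sum_comm]
        exact Finset.sum_congr rfl fun l _ => Finset.sum_comm

/-- The solution operator of `∂ₜ F = c ∑ Aᵢ ∂ᵢ F` on test functions. -/
def flowTuple (A : Fin 3 → Matrix ι ι ℝ) (c t : ℝ) : (ι → Test) →ₗ[ℝ] L2Tuple ι where
  toFun Φ := tupleL2 fun k => flow A c Φ k t
  map_add' Φ Ψ := by
    ext1 k
    exact (congrArg toL2 (funext (flow_add c Φ Ψ k t))).trans
      (toL2_add ((isTestCurve_flow c Φ k).memLp t) ((isTestCurve_flow c Ψ k).memLp t))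
  map_smul' a Φ := by
    ext1 k
    exact (congrArg toL2 (funext (flow_smul c a Φ k t))).trans
      (toL2_const_mul ((isTestCurve_flow c Φ k).memLp t) a)

/-- The solution operator of `∂ₜ F = c ∑ Aᵢ ∂ᵢ F` on `L²`, extending `flowTuple`. -/
@[irreducible]
def propagator (A : Fin 3 → Matrix ι ι ℝ) (c t : ℝ) : L2Tuple ι →L[ℝ] L2Tuple ι :=
  (flowTuple A c t).extendOfNorm testTuple

variable [DecidableEq ι]

lemma hasDerivAt_tupleL2_flow (hA : IsClifford A) (c : ℝ) (Φ : ι → Test) (t : ℝ) :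
    HasDerivAt (fun s => tupleL2 fun k => flow A c Φ k s)
      (c • tupleL2 fun k => dirac A (flow A c Φ) k t) t := by
  have hflow (k : ι) := isTestCurve_flow (A := A) c Φ k
  rw [← tupleL2_const_mul fun k => (isTestCurve_dirac hflow k).memLp t]
  simpa only [pderiv_time_flow hA] using hasDerivAt_tupleL2 hflow t

lemma inner_flow_flow (hA : IsClifford A) (c : ℝ) (Φ Ψ : ι → Test) (t s : ℝ) :
    inner ℝ (tupleL2 fun k => flow A c Φ k (t + s)) (tupleL2 fun k => flow A c Ψ k s) =
      inner ℝ (tupleL2 fun k => flow A c Φ k t) (testTuple Ψ) := by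
  have hF (k : ι) : IsTestCurve fun r => flow A c Φ k (1 * r + t) :=
    (isTestCurve_flow c Φ k).comp_affine 1 t
  have hdirac (r : ℝ) : (fun k => dirac A (fun k r => flow A c Φ k (1 * r + t)) k r) =
      fun k => dirac A (flow A c Φ) k (t + r) := by
    funext k x
    simp only [dirac, (isTestCurve_flow c Φ _).pderiv_space_comp_affine]
    rw [one_mul, add_comm]
  have hconst (r : ℝ) : HasDerivAt (fun r => inner ℝ (tupleL2 fun k => flow A c Φ k (t + r))
      (tupleL2 fun k => flow A c Ψ k r)) 0 r := by
    refine (((hasDerivAt_tupleL2_flow hA c Φ (t + r)).comp_const_add t r).inner ℝ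
      (hasDerivAt_tupleL2_flow hA c Ψ r)).congr_deriv ?_
    have hskew := inner_tupleL2_dirac hA.symm hF (fun k => isTestCurve_flow (A := A) c Ψ k) r
    rw [hdirac] at hskew
    simp only [one_mul, add_comm _ t] at hskew
    rw [inner_smul_left, inner_smul_right, hskew]
    simp
  have hs := is_const_of_deriv_eq_zero (fun r => (hconst r).differentiableAt)
    (fun r => (hconst r).deriv) s 0
  simpa only [add_zero, flow_zero, testTuple_apply] using hs

lemma norm_flowTuple (hA : IsClifford A) (c t : ℝ) (Φ : ι → Test) :
    ‖flowTuple A c t Φ‖ = ‖testTuple Φ‖ := by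
  have h := inner_flow_flow hA c Φ Φ 0 t
  simp only [zero_add, flow_zero] at h
  rw [← sq_eq_sq₀ (norm_nonneg _) (norm_nonneg _), ← real_inner_self_eq_norm_sq,
    ← real_inner_self_eq_norm_sq]
  exact h

lemma propagator_testTuple (hA : IsClifford A) (c t : ℝ) (Φ : ι → Test) :
    propagator A c t (testTuple Φ) = tupleL2 fun k => flow A c Φ k t := by
  have hext : propagator A c t (testTuple Φ) = flowTuple A c t Φ := by
    unfold propagator
    exact extendOfNorm_apply_of_norm_eq (f := flowTuple A c t) denseRange_testTuple
      (norm_flowTuple hA c t) Φ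
  exact hext

lemma propagator_zero (hA : IsClifford A) (c : ℝ) (u : L2Tuple ι) : propagator A c 0 u = u := by
  refine denseRange_testTuple.induction_on u
    (isClosed_eq (propagator A c 0).continuous continuous_id) fun Φ => ?_
  rw [propagator_testTuple hA]
  simp only [flow_zero, testTuple_apply]

lemma inner_propagator_propagator (hA : IsClifford A) (c t s : ℝ) (u v : L2Tuple ι) :
    inner ℝ (propagator A c (t + s) u) (propagator A c s v) = inner ℝ (propagator A c t u) v := by
  refine denseRange_testTuple.induction_on₂ (p := fun u v =>
    inner ℝ (propagator A c (t + s) u) (propagator A c s v) = inner ℝ (propagator A c t u) v)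
    (isClosed_eq (by fun_prop) (by fun_prop)) (fun Φ Ψ => ?_) u v
  rw [propagator_testTuple hA, propagator_testTuple hA, propagator_testTuple hA,
    inner_flow_flow hA]

lemma norm_propagator (hA : IsClifford A) (c t : ℝ) (u : L2Tuple ι) :
    ‖propagator A c t u‖ = ‖u‖ := by
  rw [← sq_eq_sq₀ (norm_nonneg _) (norm_nonneg _), ← real_inner_self_eq_norm_sq,
    ← real_inner_self_eq_norm_sq]
  simpa only [zero_add, propagator_zero hA] using inner_propagator_propagator hA c 0 t u u

lemma inner_propagator_right (hA : IsClifford A) (c t : ℝ) (u v : L2Tuple ι) :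
    inner ℝ u (propagator A c t v) = inner ℝ (propagator A c (-t) u) v := by
  simpa only [neg_add_cancel, propagator_zero hA] using inner_propagator_propagator hA c (-t) t u v

lemma propagator_propagator (hA : IsClifford A) (c s t : ℝ) (u : L2Tuple ι) :
    propagator A c s (propagator A c t u) = propagator A c (s + t) u := by
  refine ext_inner_left ℝ fun v => ?_
  have h := inner_propagator_propagator hA c (s + t) (-s) u v
  rw [show s + t + -s = t by ring] at h
  rw [inner_propagator_right hA, real_inner_comm, h, real_inner_comm]

lemma continuous_propagator (hA : IsClifford A) (c : ℝ) :
    Continuous fun p : L2Tuple ι × ℝ => propagator A c p.2 p.1 := by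
  refine continuous_prod_of_dense_continuous_lipschitzWith _ 1 denseRange_testTuple ?_ fun t => ?_
  · rintro _ ⟨Φ, rfl⟩
    simp only [propagator_testTuple hA]
    exact continuous_tupleL2 fun k => isTestCurve_flow c Φ k
  · refine LipschitzWith.of_dist_le_mul fun u v => ?_
    rw [dist_eq_norm, dist_eq_norm, ← map_sub, norm_propagator hA, NNReal.coe_one, one_mul]

lemma hasDerivAt_propagator_testTuple (hA : IsClifford A) (c : ℝ) (Φ : ι → Test) :
    HasDerivAt (fun t => propagator A c t (testTuple Φ))
      (c • tupleL2 fun k => dirac A (fun k _ => Φ k) k 0) 0 := by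
  have hinit : (fun k => dirac A (flow A c Φ) k 0) = fun k => dirac A (fun k _ => Φ k) k 0 := by
    funext k x
    simp only [dirac, (isTestCurve_flow c Φ _).pderiv_space, (IsTestCurve.of_test _).pderiv_space,
      flow_zero]
  simpa only [propagator_testTuple hA, hinit] using hasDerivAt_tupleL2_flow hA c Φ 0

end Propagator

/-! ### Weak derivatives in time -/

section WeakDerivative

variable {F : Type*} [NormedAddCommGroup F] [NormedSpace ℝ F]

lemma integral_eq_zero_of_hasCompactSupport_of_hasDerivAt {f f' : ℝ → F}
    (hf : HasCompactSupport f) (hderiv : ∀ t, HasDerivAt f (f' t) t) (hf' : Continuous f') :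
    ∫ t, f' t = 0 := by
  have hf'_supp : HasCompactSupport f' := by
    have : deriv f = f' := funext fun t => (hderiv t).deriv
    exact this ▸ hf.deriv
  have hf_cont : Continuous f := continuous_iff_continuousAt.2 fun t => (hderiv t).continuousAt
  exact integral_eq_zero_of_hasDerivAt_of_integrable hderiv
    (hf'.integrable_of_hasCompactSupport hf'_supp) (hf_cont.integrable_of_hasCompactSupport hf)

lemma exists_hasCompactSupport_deriv_eq [CompleteSpace F] {g : ℝ → F} (hg : ContDiff ℝ ∞ g)
    (hg_supp : HasCompactSupport g) (hint : ∫ t, g t = 0) :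
    ∃ η : ℝ → F, ContDiff ℝ ∞ η ∧ HasCompactSupport η ∧ deriv η = g := by
  obtain ⟨R, hR⟩ := exists_forall_norm_gt_eq_zero hg_supp
  let η : ℝ → F := fun s => ∫ r in (-(R + 1))..s, g r
  have hη (t : ℝ) : HasDerivAt η (g t) t :=
    intervalIntegral.integral_hasDerivAt_right (hg.continuous.intervalIntegrable _ _)
      (hg.continuous.stronglyMeasurableAtFilter _ _) hg.continuous.continuousAt
  have hderiv : deriv η = g := funext fun t => (hη t).deriv
  refine ⟨η, contDiff_infty_iff_deriv.2 ⟨fun t => (hη t).differentiableAt, hderiv.symm ▸ hg⟩,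
    ?_, hderiv⟩
  refine HasCompactSupport.intro (isCompact_closedBall (0 : ℝ) (R + 1)) fun s hs => ?_
  rw [mem_closedBall_zero_iff, not_le, Real.norm_eq_abs, lt_abs] at hs
  rcases hs with hs | hs
  · refine (intervalIntegral.integral_eq_integral_of_support_subset fun r hr => ?_).trans hint
    have hr_le : |r| ≤ R := not_lt.1 fun h => hr (hR r h)
    exact ⟨by linarith [neg_abs_le r], by linarith [le_abs_self r]⟩
  · refine intervalIntegral.integral_zero_ae (Filter.Eventually.of_forall fun r hr => hR r ?_)
    rw [Set.uIoc_of_ge (by linarith)] at hr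
    rw [Real.norm_eq_abs, lt_abs]
    exact Or.inr (by linarith [hr.2])

lemma eq_of_forall_integral_smul_eq_zero {E : Type*} [NormedAddCommGroup E] [NormedSpace ℝ E]
    [FiniteDimensional ℝ E] [MeasurableSpace E] [BorelSpace E] {μ : Measure E}
    [IsLocallyFiniteMeasure μ] [μ.IsOpenPosMeasure] [CompleteSpace F] {w : E → F}
    (hw : Continuous w)
    (h : ∀ g : E → ℝ, ContDiff ℝ ∞ g → HasCompactSupport g → ∫ x, g x ∂μ = 0 →
      ∫ x, g x • w x ∂μ = 0) (x y : E) :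
    w x = w y := by
  let bump : ContDiffBump (0 : E) := ⟨1, 2, one_pos, one_lt_two⟩
  let θ : E → ℝ := bump.normed μ
  have hθ : ContDiff ℝ ∞ θ := bump.contDiff_normed
  have hθ_supp : HasCompactSupport θ := bump.hasCompactSupport_normed
  have integrable_smul {g : E → ℝ} {v : E → F} (hg : ContDiff ℝ ∞ g)
      (hg_supp : HasCompactSupport g) (hv : Continuous v) : Integrable (fun x => g x • v x) μ :=
    (hg.continuous.smul hv).integrable_of_hasCompactSupport hg_supp.smul_right
  let mean : F := ∫ x, θ x • w x ∂μ
  have hae : ∀ᵐ x ∂μ, w x - mean = 0 := by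
    refine ae_eq_zero_of_integral_contDiff_smul_eq_zero
      ((hw.sub continuous_const).locallyIntegrable) fun g hg hg_supp => ?_
    have hg_int : Integrable g μ := hg.continuous.integrable_of_hasCompactSupport hg_supp
    have hθ_int : Integrable θ μ := hθ.continuous.integrable_of_hasCompactSupport hθ_supp
    -- Subtracting a multiple of the bump function makes the mean of `g` vanish.
    have hcorrected := h (fun x => g x - (∫ z, g z ∂μ) * θ x) (hg.sub (contDiff_const.mul hθ))
      (hg_supp.sub hθ_supp.mul_left) (by
        rw [integral_sub hg_int (hθ_int.const_mul _), integral_const_mul,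
          show ∫ x, θ x ∂μ = 1 from bump.integral_normed, mul_one, sub_self])
    simp only [sub_smul, mul_smul] at hcorrected
    have hθw_int : Integrable (fun x => (∫ z, g z ∂μ) • θ x • w x) μ :=
      (integrable_smul hθ hθ_supp hw).smul _
    rw [integral_sub (integrable_smul hg hg_supp hw) hθw_int, integral_smul] at hcorrected
    simp only [smul_sub]
    rw [integral_sub (integrable_smul hg hg_supp hw) (hg_int.smul_const _), integral_smul_const]
    exact hcorrected
  have hconst : w = fun _ => mean :=
    (hw.ae_eq_iff_eq μ continuous_const).1 (hae.mono fun _ hx => sub_eq_zero.1 hx)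
  rw [hconst]

lemma sub_eq_integral_of_weak_deriv [CompleteSpace F] {h k : ℝ → F} (hh : Continuous h)
    (hk : Continuous k)
    (hweak : ∀ η : ℝ → ℝ, ContDiff ℝ ∞ η → HasCompactSupport η →
      ∫ t, (deriv η t • h t + η t • k t) = 0) (a b : ℝ) :
    h b - h a = ∫ t in a..b, k t := by
  let P : ℝ → F := fun s => ∫ r in a..s, k r
  have hP (t : ℝ) : HasDerivAt P (k t) t :=
    intervalIntegral.integral_hasDerivAt_right (hk.intervalIntegrable _ _)
      (hk.stronglyMeasurableAtFilter _ _) hk.continuousAt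
  have hP_cont : Continuous P := continuous_iff_continuousAt.2 fun t => (hP t).continuousAt
  have hconst : h b - P b = h a - P a := by
    refine eq_of_forall_integral_smul_eq_zero (w := fun t => h t - P t) (μ := volume)
      (hh.sub hP_cont) (fun g hg hg_supp hg_int => ?_) b a
    obtain ⟨η, hη, hη_supp, rfl⟩ := exists_hasCompactSupport_deriv_eq hg hg_supp hg_int
    have hη_deriv (t : ℝ) : HasDerivAt η (deriv η t) t :=
      (hη.differentiable (by simp) t).hasDerivAt
    have integrable {v : ℝ → F} (hv : Continuous v) :
        Integrable fun t => deriv η t • v t + η t • k t :=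
      ((hg.continuous.smul hv).integrable_of_hasCompactSupport hg_supp.smul_right).add
        ((hη.continuous.smul hk).integrable_of_hasCompactSupport hη_supp.smul_right)
    have hprod : ∫ t, (deriv η t • P t + η t • k t) = 0 :=
      integral_eq_zero_of_hasCompactSupport_of_hasDerivAt
        (f := fun t => η t • P t) hη_supp.smul_right
        (fun t => ((hη_deriv t).smul (hP t)).congr_deriv (add_comm _ _))
        ((hg.continuous.smul hP_cont).add (hη.continuous.smul hk))
    have hdiff := integral_sub (integrable hh) (integrable hP_cont)
    rw [hweak η hη hη_supp, hprod, sub_zero] at hdiff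
    simpa only [add_sub_add_right_eq_sub, ← smul_sub] using hdiff
  have hPa : P a = 0 := intervalIntegral.integral_same
  rw [hPa, sub_zero, sub_eq_iff_eq_add] at hconst
  rw [hconst, add_sub_cancel_left]

end WeakDerivative

/-! ### Balance laws and Duhamel's formula -/

section BalanceLaw

/-- The pairing of `r - ∂ₜ f - ∑ ∂ᵢ gᵢ` with a test curve, at a fixed time; the derivatives are
moved to the test curve. -/
def balancePairing (f : ℝ → L2) (g : Fin 3 → ℝ → L2) (r : ℝ → L2) (F : ℝ → Space → ℝ) (t : ℝ) :
    ℝ :=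
  inner ℝ (f t) (toL2 (pderiv timeDir F t))
    + ∑ i, inner ℝ (g i t) (toL2 (pderiv (spaceDir i) F t)) + inner ℝ (r t) (toL2 (F t))

/-- The value at `φ` of the distribution `r - ∂ₜ f - ∑ ∂ᵢ gᵢ` on `ℝ × ℝ³`. -/
def balanceResidual (f : ℝ → L2) (g : Fin 3 → ℝ → L2) (r : ℝ → L2) (φ : STTest) : ℝ :=
  ∫ t, balancePairing f g r (fun t x => φ (t, x)) t

/-- The balance law `∂ₜ f + ∑ ∂ᵢ gᵢ = r` in the sense of distributions on `ℝ × ℝ³`. -/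
def IsBalanceLaw (f : ℝ → L2) (g : Fin 3 → ℝ → L2) (r : ℝ → L2) : Prop :=
  ∀ φ : STTest, balanceResidual f g r φ = 0

variable {f r : ℝ → L2} {g : Fin 3 → ℝ → L2} {F : ℝ → Space → ℝ}

lemma continuous_balancePairing (hf : Continuous f) (hg : ∀ i, Continuous (g i))
    (hr : Continuous r) (hF : IsTestCurve F) : Continuous (balancePairing f g r F) :=
  ((hf.inner (hF.pderiv _).continuous_toL2).add
    (continuous_finsetSum _ fun i _ => (hg i).inner (hF.pderiv _).continuous_toL2)).add
    (hr.inner hF.continuous_toL2)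

lemma balancePairing_mul_left (hF : IsTestCurve F) {η : ℝ → ℝ} (hη : ContDiff ℝ ∞ η) (t : ℝ) :
    balancePairing f g r (fun t x => η t * F t x) t =
      deriv η t * inner ℝ (f t) (toL2 (F t)) + η t * balancePairing f g r F t := by
  have hηF := hF.mul_left hη
  have hη_deriv : HasDerivAt η (deriv η t) t := (hη.differentiable (by simp) t).hasDerivAt
  have htime : toL2 (pderiv timeDir (fun t x => η t * F t x) t) =
      deriv η t • toL2 (F t) + η t • toL2 (pderiv timeDir F t) := by
    rw [← toL2_const_mul (hF.memLp t), ← toL2_const_mul ((hF.pderiv _).memLp t),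
      ← toL2_add ((hF.memLp t).const_mul _) (((hF.pderiv _).memLp t).const_mul _)]
    congr 1
    funext x
    exact (hηF.hasDerivAt_time t x).unique (hη_deriv.mul (hF.hasDerivAt_time t x))
  have hspace (i : Fin 3) : toL2 (pderiv (spaceDir i) (fun t x => η t * F t x) t) =
      η t • toL2 (pderiv (spaceDir i) F t) := by
    rw [← toL2_const_mul ((hF.pderiv _).memLp t)]
    congr 1
    funext x
    rw [hηF.pderiv_space, hF.pderiv_space,
      fderiv_const_mul ((hF.contDiff_slice t).differentiable (by simp) x)]
    rfl
  simp only [balancePairing, htime, hspace, toL2_const_mul (hF.memLp t), inner_add_right,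
    inner_smul_right, ← Finset.mul_sum]
  ring

lemma IsBalanceLaw.inner_sub_inner (h : IsBalanceLaw f g r) (hf : Continuous f)
    (hg : ∀ i, Continuous (g i)) (hr : Continuous r) (hF : IsTestCurve F) (a b : ℝ) :
    inner ℝ (f b) (toL2 (F b)) - inner ℝ (f a) (toL2 (F a)) =
      ∫ t in a..b, balancePairing f g r F t := by
  refine sub_eq_integral_of_weak_deriv (h := fun t => inner ℝ (f t) (toL2 (F t)))
    (hf.inner hF.continuous_toL2) (continuous_balancePairing hf hg hr hF)
    (fun η hη hη_supp => ?_) a b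
  simp only [smul_eq_mul, ← balancePairing_mul_left hF hη]
  exact h (hF.toSpaceTime hη hη_supp)

end BalanceLaw

section Duhamel

variable {ι : Type*} [Fintype ι] {A : Fin 3 → Matrix ι ι ℝ}

/-- The fluxes of the system `∂ₜ V = c ∑ Aᵢ ∂ᵢ V + S`, read as a family of balance laws. -/
def flux (A : Fin 3 → Matrix ι ι ℝ) (c : ℝ) (V : ℝ → L2Tuple ι) (k : ι) (i : Fin 3) (t : ℝ) : L2 :=
  (-c) • ∑ l, A i k l • V t l

/-- The value at `φ` of the `k`-th component of `S + c ∑ Aᵢ ∂ᵢ V - ∂ₜ V`, a distribution on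
`ℝ × ℝ³`. -/
def weakResidual (A : Fin 3 → Matrix ι ι ℝ) (c : ℝ) (V S : ℝ → L2Tuple ι) (k : ι) :
    STTest → ℝ :=
  balanceResidual (fun t => V t k) (flux A c V k) (fun t => S t k)

/-- The equation `∂ₜ V = c ∑ Aᵢ ∂ᵢ V + S` in the sense of distributions on `ℝ × ℝ³`. -/
def IsWeakSolution (A : Fin 3 → Matrix ι ι ℝ) (c : ℝ) (V S : ℝ → L2Tuple ι) : Prop :=
  ∀ k φ, weakResidual A c V S k φ = 0

lemma continuous_flux {V : ℝ → L2Tuple ι} (hV : Continuous V) (c : ℝ) (k : ι) (i : Fin 3) :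
    Continuous (flux A c V k i) := by
  have := continuous_tuple_apply hV
  unfold flux
  fun_prop

lemma continuous_balancePairing_flux {V S : ℝ → L2Tuple ι} (hV : Continuous V) (hS : Continuous S)
    (c : ℝ) (k : ι) {F : ℝ → Space → ℝ} (hF : IsTestCurve F) :
    Continuous (balancePairing (fun t => V t k) (flux A c V k) (fun t => S t k) F) :=
  continuous_balancePairing (continuous_tuple_apply hV k) (continuous_flux hV c k)
    (continuous_tuple_apply hS k) hF

lemma sum_balancePairing (hA : ∀ i, (A i).IsSymm) (c : ℝ) (V S : ℝ → L2Tuple ι)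
    {F : ι → ℝ → Space → ℝ} (hF : ∀ k, IsTestCurve (F k)) (t : ℝ) :
    ∑ k, balancePairing (fun t => V t k) (flux A c V k) (fun t => S t k) (F k) t =
      inner ℝ (V t) ((tupleL2 fun k => pderiv timeDir (F k) t)
          - c • tupleL2 fun k => dirac A F k t)
        + inner ℝ (S t) (tupleL2 fun k => F k t) := by
  have hflux : ∑ k, ∑ i, inner ℝ (flux A c V k i t) (toL2 (pderiv (spaceDir i) (F k) t)) =
      -(c * inner ℝ (V t) (tupleL2 fun k => dirac A F k t)) := by
    simp only [flux, inner_tupleL2, toL2_dirac hF, inner_sum, sum_inner, inner_smul_left,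
      inner_smul_right, RCLike.conj_to_real, Finset.mul_sum, ← Finset.sum_neg_distrib]
    rw [Finset.sum_comm, Finset.sum_comm (s := Finset.univ (α := ι))]
    refine Finset.sum_congr rfl fun i _ => ?_
    rw [Finset.sum_comm]
    refine Finset.sum_congr rfl fun k _ => Finset.sum_congr rfl fun l _ => ?_
    rw [(hA i).apply l k]
    ring
  simp only [balancePairing, Finset.sum_add_distrib, hflux, inner_sub_right, inner_smul_right,
    inner_tupleL2 _ fun k => F k t, inner_tupleL2 _ fun k => pderiv timeDir (F k) t]
  ring

variable [DecidableEq ι]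

lemma hasDerivAt_propagator_sub_testTuple (hA : IsClifford A) (c : ℝ) {F : ι → ℝ → Space → ℝ}
    (hF : ∀ k, IsTestCurve (F k)) (t : ℝ) :
    HasDerivAt (fun s => propagator A c (t - s) (tupleL2 fun k => F k t))
      (-(c • tupleL2 fun k => dirac A F k t)) t := by
  have h := hasDerivAt_propagator_testTuple hA c fun k => (hF k).slice t
  have hdirac : (tupleL2 fun k => dirac A (fun k _ => (hF k).slice t) k 0) =
      tupleL2 fun k => dirac A F k t := by
    congr 1
    funext k x
    simp only [dirac, (hF _).pderiv_space, (IsTestCurve.of_test _).pderiv_space]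
    rfl
  rw [hdirac] at h
  have hcomp := HasDerivAt.scomp_of_eq
    (g₁ := fun s => propagator A c s (testTuple fun k => (hF k).slice t)) t h
    ((hasDerivAt_id t).const_sub t) (sub_self t).symm
  rwa [neg_one_smul] at hcomp

lemma hasDerivAt_propagator_sub (hA : IsClifford A) (c : ℝ) {F : ι → ℝ → Space → ℝ}
    (hF : ∀ k, IsTestCurve (F k)) (t : ℝ) :
    HasDerivAt (fun s => propagator A c (t - s) (tupleL2 fun k => F k s))
      ((tupleL2 fun k => pderiv timeDir (F k) t) - c • tupleL2 fun k => dirac A F k t) t := by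
  have hprop := hasDerivAt_iff_tendsto_slope.1 (hasDerivAt_propagator_sub_testTuple hA c hF t)
  have hcurve := hasDerivAt_iff_tendsto_slope.1 (hasDerivAt_tupleL2 hF t)
  have htime : Filter.Tendsto (fun s : ℝ => t - s) (nhdsWithin t {t}ᶜ) (nhds (t - t)) :=
    ((continuous_const.sub continuous_id).tendsto t).mono_left nhdsWithin_le_nhds
  -- Joint continuity of the propagator allows to replace `U(t - s)` by its limit in the slope of
  -- the curve.
  have hlim := ((continuous_propagator hA c).tendsto (_, t - t)).comp (hcurve.prodMk_nhds htime)
  simp only [sub_self, propagator_zero hA] at hlim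
  rw [hasDerivAt_iff_tendsto_slope, sub_eq_add_neg]
  refine (hlim.add hprop).congr fun s => ?_
  simp only [Function.comp, slope_def_module, map_smul, map_sub, sub_self]
  rw [← smul_add]
  congr 1
  abel

lemma hasDerivAt_propagator_neg (hA : IsClifford A) (c : ℝ) {F : ι → ℝ → Space → ℝ}
    (hF : ∀ k, IsTestCurve (F k)) (t : ℝ) :
    HasDerivAt (fun s => propagator A c (-s) (tupleL2 fun k => F k s))
      (propagator A c (-t)
        ((tupleL2 fun k => pderiv timeDir (F k) t) - c • tupleL2 fun k => dirac A F k t)) t := by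
  refine ((propagator A c (-t)).hasFDerivAt.comp_hasDerivAt t
    (hasDerivAt_propagator_sub hA c hF t)).congr_of_eventuallyEq
    (Filter.Eventually.of_forall fun s => ?_)
  simp only [Function.comp, propagator_propagator hA]
  rw [neg_add_eq_sub, sub_sub_cancel_left]

/-- Duhamel's formula for the solution of `∂ₜ V = c ∑ Aᵢ ∂ᵢ V + S` with `V(0) = V₀`. -/
def duhamel (A : Fin 3 → Matrix ι ι ℝ) (c : ℝ) (V₀ : L2Tuple ι) (S : ℝ → L2Tuple ι) (t : ℝ) :
    L2Tuple ι :=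
  propagator A c t (V₀ + ∫ s in (0 : ℝ)..t, propagator A c (-s) (S s))

lemma duhamel_zero (hA : IsClifford A) (c : ℝ) (V₀ : L2Tuple ι) (S : ℝ → L2Tuple ι) :
    duhamel A c V₀ S 0 = V₀ := by
  rw [duhamel, intervalIntegral.integral_same, add_zero, propagator_zero hA]

variable {S : ℝ → L2Tuple ι}

lemma hasDerivAt_integral_propagator (hA : IsClifford A) (c : ℝ) (V₀ : L2Tuple ι)
    (hS : Continuous S) (t : ℝ) :
    HasDerivAt (fun t => V₀ + ∫ s in (0 : ℝ)..t, propagator A c (-s) (S s))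
      (propagator A c (-t) (S t)) t := by
  have hcont : Continuous fun s => propagator A c (-s) (S s) :=
    (continuous_propagator hA c).comp (hS.prodMk continuous_neg)
  exact (intervalIntegral.integral_hasDerivAt_right (hcont.intervalIntegrable _ _)
    (hcont.stronglyMeasurableAtFilter _ _) hcont.continuousAt).const_add _

lemma continuous_duhamel (hA : IsClifford A) (c : ℝ) (V₀ : L2Tuple ι) (hS : Continuous S) :
    Continuous (duhamel A c V₀ S) := by
  have hcont : Continuous fun t => V₀ + ∫ s in (0 : ℝ)..t, propagator A c (-s) (S s) :=
    continuous_iff_continuousAt.2 fun t =>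
      (hasDerivAt_integral_propagator hA c V₀ hS t).continuousAt
  exact (continuous_propagator hA c).comp (hcont.prodMk continuous_id)

lemma hasDerivAt_norm_sq_duhamel (hA : IsClifford A) (c : ℝ) (V₀ : L2Tuple ι)
    (hS : Continuous S) (t : ℝ) :
    HasDerivAt (fun t => ‖duhamel A c V₀ S t‖ ^ 2) (2 * inner ℝ (duhamel A c V₀ S t) (S t)) t := by
  have h := (hasDerivAt_integral_propagator hA c V₀ hS t).norm_sq
  simp only [duhamel, norm_propagator hA]
  rwa [inner_propagator_right hA, neg_neg] at h

lemma hasDerivAt_inner_duhamel (hA : IsClifford A) (c : ℝ) (V₀ : L2Tuple ι) (hS : Continuous S)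
    {F : ι → ℝ → Space → ℝ} (hF : ∀ k, IsTestCurve (F k)) (t : ℝ) :
    HasDerivAt (fun t => inner ℝ (duhamel A c V₀ S t) (tupleL2 fun k => F k t))
      (∑ k, balancePairing (fun t => duhamel A c V₀ S t k) (flux A c (duhamel A c V₀ S) k)
        (fun t => S t k) (F k) t) t := by
  have hadj (s : ℝ) (u v : L2Tuple ι) :
      inner ℝ (propagator A c s u) v = inner ℝ u (propagator A c (-s) v) := by
    rw [inner_propagator_right hA, neg_neg]
  rw [sum_balancePairing hA.symm c _ S hF]
  simp only [duhamel, hadj]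
  refine ((hasDerivAt_integral_propagator hA c V₀ hS t).inner ℝ
    (hasDerivAt_propagator_neg hA c hF t)).congr_deriv ?_
  congr 1
  rw [← hadj, propagator_propagator hA, add_neg_cancel, propagator_zero hA]

lemma hasDerivAt_inner_duhamel_apply (hA : IsClifford A) (c : ℝ) (V₀ : L2Tuple ι)
    (hS : Continuous S) (k : ι) {F : ℝ → Space → ℝ} (hF : IsTestCurve F) (t : ℝ) :
    HasDerivAt (fun t => inner ℝ (duhamel A c V₀ S t k) (toL2 (F t)))
      (balancePairing (fun t => duhamel A c V₀ S t k) (flux A c (duhamel A c V₀ S) k)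
        (fun t => S t k) F t) t := by
  let F' : ι → ℝ → Space → ℝ := Function.update (fun _ _ _ => 0) k F
  have hF'_same : F' k = F := Function.update_self ..
  have hF'_ne {l : ι} (hl : l ≠ k) : F' l = fun _ _ => 0 := Function.update_of_ne hl ..
  have hF' (l : ι) : IsTestCurve (F' l) := by
    rcases eq_or_ne l k with rfl | hl
    · rwa [hF'_same]
    · rw [hF'_ne hl]
      exact .zero
  refine ((hasDerivAt_inner_duhamel hA c V₀ hS hF' t).congr_deriv ?_).congr_of_eventuallyEq
    (Filter.Eventually.of_forall fun s => ?_)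
  · rw [Finset.sum_eq_single k, hF'_same]
    · intro l _ hl
      have hpderiv (v : ℝ × Space) : pderiv v (fun _ _ => 0) t = fun _ => (0 : ℝ) := by
        funext x
        simp [pderiv]
      simp only [balancePairing, hF'_ne hl, hpderiv, toL2_zero, inner_zero_right,
        Finset.sum_const_zero, add_zero]
    · simp
  · beta_reduce
    rw [inner_tupleL2, Finset.sum_eq_single k, hF'_same]
    · intro l _ hl
      rw [hF'_ne hl, toL2_zero, inner_zero_right]
    · simp

lemma isWeakSolution_duhamel (hA : IsClifford A) (c : ℝ) (V₀ : L2Tuple ι) (hS : Continuous S) :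
    IsWeakSolution A c (duhamel A c V₀ S) S := by
  intro k φ
  obtain ⟨R, hR⟩ := exists_forall_norm_gt_eq_zero φ.hasCompactSupport
  refine integral_eq_zero_of_hasCompactSupport_of_hasDerivAt
    (.intro (isCompact_closedBall (0 : ℝ) R) fun t ht => ?_)
    (hasDerivAt_inner_duhamel_apply hA c V₀ hS k (.of_spaceTime_test φ))
    (continuous_balancePairing_flux (continuous_duhamel hA c V₀ hS) hS c k (.of_spaceTime_test φ))
  rw [mem_closedBall_zero_iff, not_le] at ht
  have hzero : (fun x => φ (t, x)) = fun _ => 0 :=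
    funext fun x => hR _ (ht.trans_le (norm_fst_le (t, x)))
  rw [hzero, toL2_zero, inner_zero_right]

lemma IsWeakSolution.inner_testTuple (hA : IsClifford A) {c : ℝ} {V S : ℝ → L2Tuple ι}
    (h : IsWeakSolution A c V S) (hV : Continuous V) (hS : Continuous S) (Φ : ι → Test) (t : ℝ) :
    inner ℝ (V t) (testTuple Φ) = inner ℝ (V 0) (tupleL2 fun k => flow A c Φ k (-t))
      + ∫ s in (0 : ℝ)..t, inner ℝ (S s) (tupleL2 fun k => flow A c Φ k (s - t)) := by
  have hflow (k : ι) := isTestCurve_flow (A := A) c Φ k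
  -- The flow of `Φ` ending at time `t` solves the adjoint equation.
  let F : ι → ℝ → Space → ℝ := fun k s => flow A c Φ k (1 * s + (-t))
  have hF (k : ι) : IsTestCurve (F k) := (hflow k).comp_affine 1 (-t)
  have hF_apply (s : ℝ) : (fun k => F k s) = fun k => flow A c Φ k (s - t) := by
    simp only [F, one_mul, ← sub_eq_add_neg]
  have hadjoint (s : ℝ) :
      (tupleL2 fun k => pderiv timeDir (F k) s) - (c • tupleL2 fun k => dirac A F k s) = 0 := by
    rw [sub_eq_zero, ← tupleL2_const_mul fun k => (isTestCurve_dirac hF k).memLp s]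
    congr 1
    funext k x
    rw [(hflow k).pderiv_time_comp_affine, pderiv_time_flow hA, one_mul]
    simp only [dirac, F, (hflow _).pderiv_space_comp_affine]
  have hbalance := Finset.sum_congr rfl fun k (_ : k ∈ Finset.univ) =>
    IsBalanceLaw.inner_sub_inner (h k) (continuous_tuple_apply hV k) (continuous_flux hV c k)
      (continuous_tuple_apply hS k) (hF k) 0 t
  rw [Finset.sum_sub_distrib, ← intervalIntegral.integral_finsetSum fun k _ =>
    (continuous_balancePairing_flux hV hS c k (hF k)).intervalIntegrable 0 t] at hbalance
  simp only [sum_balancePairing hA.symm c V S hF, hadjoint, inner_zero_right, zero_add,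
    ← inner_tupleL2 _ fun k => F k _, hF_apply, sub_self, zero_sub, flow_zero] at hbalance
  rw [testTuple_apply]
  linarith

lemma inner_duhamel_testTuple (hA : IsClifford A) (c : ℝ) (V₀ : L2Tuple ι) (hS : Continuous S)
    (Φ : ι → Test) (t : ℝ) :
    inner ℝ (duhamel A c V₀ S t) (testTuple Φ) =
      inner ℝ V₀ (tupleL2 fun k => flow A c Φ k (-t))
        + ∫ s in (0 : ℝ)..t, inner ℝ (S s) (tupleL2 fun k => flow A c Φ k (s - t)) := by
  have h := (isWeakSolution_duhamel hA c V₀ hS).inner_testTuple hA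
    (continuous_duhamel hA c V₀ hS) hS Φ t
  rwa [duhamel_zero hA] at h

lemma IsWeakSolution.eq_duhamel (hA : IsClifford A) {c : ℝ} {V S : ℝ → L2Tuple ι}
    (h : IsWeakSolution A c V S) (hV : Continuous V) (hS : Continuous S) (t : ℝ) :
    V t = duhamel A c (V 0) S t :=
  ext_inner_testTuple fun Φ => by
    rw [h.inner_testTuple hA hV hS, inner_duhamel_testTuple hA c _ hS]

end Duhamel

/-! ### The Maxwell equations as a first order system -/

section Coordinates

/-- The `i`-th component of a square integrable vector field. -/
def coord (i : Fin 3) : L2V →L[ℝ] L2 :=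
  (EuclideanSpace.proj i : Space →L[ℝ] ℝ).compLpL 2 volume

/-- The square integrable vector field with a given `j`-th component and vanishing other
components. -/
def ofCoord (j : Fin 3) : L2 →L[ℝ] L2V :=
  (ContinuousLinearMap.toSpanSingleton ℝ (e j)).compLpL 2 volume

/-- The square integrable vector field with given components. -/
def ofCoords (f : Fin 3 → L2) : L2V := ∑ i, ofCoord i (f i)

lemma coord_ae (i : Fin 3) (F : L2V) : coord i F =ᵐ[volume] fun x => F x i :=
  (EuclideanSpace.proj i : Space →L[ℝ] ℝ).coeFn_compLpL F

lemma coord_ofCoord (i j : Fin 3) (f : L2) : coord i (ofCoord j f) = if i = j then f else 0 := by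
  ext1
  filter_upwards [coord_ae i (ofCoord j f),
    (ContinuousLinearMap.toSpanSingleton ℝ (e j)).coeFn_compLpL (p := 2) (μ := volume) f,
    Lp.coeFn_zero ℝ 2 (volume : Measure Space)] with x hcoord hsingle hzero
  rw [hcoord, ofCoord, hsingle]
  split_ifs with hij
  · simp [hij]
  · rw [hzero]
    simp [hij]

lemma coord_ofCoords (f : Fin 3 → L2) (i : Fin 3) : coord i (ofCoords f) = f i := by
  simp [ofCoords, coord_ofCoord]

lemma continuous_ofCoords {f : ℝ → Fin 3 → L2} (hf : ∀ i, Continuous fun t => f t i) :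
    Continuous fun t => ofCoords (f t) :=
  continuous_finsetSum _ fun i _ => (ofCoord i).continuous.comp (hf i)

lemma ext_coord {F G : L2V} (h : ∀ i, coord i F = coord i G) : F = G := by
  ext1
  have hcoord : ∀ᵐ x, ∀ i, F x i = G x i := by
    refine ae_all_iff.2 fun i => ?_
    filter_upwards [coord_ae i F, coord_ae i G] with x hF hG
    rw [← hF, ← hG, h]
  filter_upwards [hcoord] with x hx
  ext i
  exact hx i

lemma inner_coord (i : Fin 3) (F : L2V) {f : Space → ℝ} (hf : MemLp f 2 volume) :
    inner ℝ (coord i F) (toL2 f) = ∫ x, F x i * f x := by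
  rw [inner_toL2 _ hf]
  refine integral_congr_ae ?_
  filter_upwards [coord_ae i F] with x hx
  rw [hx]

lemma integrable_norm_sq (F : L2V) : Integrable fun x => ‖F x‖ ^ 2 :=
  (memLp_two_iff_integrable_sq_norm (Lp.memLp F).1).1 (Lp.memLp F)

lemma sum_norm_sq_coord (F : L2V) : ∑ i, ‖coord i F‖ ^ 2 = ∫ x, ‖F x‖ ^ 2 := by
  have hnorm (i : Fin 3) : ‖coord i F‖ ^ 2 = ∫ x, (F x i) ^ 2 := by
    rw [← real_inner_self_eq_norm_sq, L2.inner_def]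
    refine integral_congr_ae ?_
    filter_upwards [coord_ae i F] with x hx
    rw [hx, real_inner_self_eq_norm_sq, Real.norm_eq_abs, sq_abs]
  have hint (i : Fin 3) : Integrable fun x => (F x i) ^ 2 := by
    refine ((Lp.memLp (coord i F)).integrable_sq).congr ?_
    filter_upwards [coord_ae i F] with x hx
    rw [hx]
  simp only [hnorm, EuclideanSpace.real_norm_sq_eq]
  exact (integral_finsetSum _ fun i _ => hint i).symm

end Coordinates

section Pairing

/-- The value at `φ` of the distribution on `ℝ × ℝ³` given by a curve in `L²`. -/
def pairL2 (f : ℝ → L2) (φ : STTest) : ℝ := ∫ t, inner ℝ (f t) (toL2 fun x => φ (t, x))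

lemma pair_eq_pairL2 (f : ℝ → L2) (φ : STTest) : pair (fun t => f t) φ = pairL2 f φ := by
  simp only [pair, pairL2, inner_toL2 _ ((IsTestCurve.of_spaceTime_test φ).memLp _)]

lemma pair_comp_eq_pairL2 (F : ℝ → L2V) (i : Fin 3) (φ : STTest) :
    pair (comp F i) φ = pairL2 (fun t => coord i (F t)) φ := by
  simp only [pair, pairL2, comp, inner_coord _ _ ((IsTestCurve.of_spaceTime_test φ).memLp _)]

lemma dt_eq_pairL2 (f : ℝ → L2) (φ : STTest) :
    dt (fun t => f t) φ = -pairL2 f (∂_{((1 : ℝ), (0 : Space))} φ) := by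
  rw [dt, pair_eq_pairL2]

lemma dt_comp_eq_pairL2 (F : ℝ → L2V) (i : Fin 3) (φ : STTest) :
    dt (comp F i) φ = -pairL2 (fun t => coord i (F t)) (∂_{((1 : ℝ), (0 : Space))} φ) := by
  rw [dt, pair_comp_eq_pairL2]

lemma dx_comp_eq_pairL2 (F : ℝ → L2V) (i k : Fin 3) (φ : STTest) :
    dx k (comp F i) φ = -pairL2 (fun t => coord i (F t)) (∂_{((0 : ℝ), e k)} φ) := by
  rw [dx, pair_comp_eq_pairL2]

lemma integrable_inner_toL2_test {f : ℝ → L2} (hf : Continuous f) (φ : STTest) :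
    Integrable fun t => inner ℝ (f t) (toL2 fun x => φ (t, x)) := by
  obtain ⟨R, hR⟩ := exists_forall_norm_gt_eq_zero φ.hasCompactSupport
  refine (hf.inner
    (IsTestCurve.of_spaceTime_test φ).continuous_toL2).integrable_of_hasCompactSupport
      (.intro (isCompact_closedBall (0 : ℝ) R) fun t ht => ?_)
  rw [mem_closedBall_zero_iff, not_le] at ht
  have hzero : (fun x => φ (t, x)) = fun _ => 0 :=
    funext fun x => hR _ (ht.trans_le (norm_fst_le (t, x)))
  rw [hzero, toL2_zero, inner_zero_right]

lemma pairL2_smul (a : ℝ) (f : ℝ → L2) (φ : STTest) :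
    pairL2 (fun t => a • f t) φ = a * pairL2 f φ := by
  simp only [pairL2, inner_smul_left, RCLike.conj_to_real, integral_const_mul]

lemma pairL2_zero (φ : STTest) : pairL2 (fun _ => 0) φ = 0 := by
  simp only [pairL2, inner_zero_left, integral_zero]

lemma pairL2_sum {κ : Type*} (s : Finset κ) {f : κ → ℝ → L2} (hf : ∀ k ∈ s, Continuous (f k))
    (φ : STTest) : pairL2 (fun t => ∑ k ∈ s, f k t) φ = ∑ k ∈ s, pairL2 (f k) φ := by
  simp only [pairL2, sum_inner]
  exact integral_finsetSum _ fun k hk => integrable_inner_toL2_test (hf k hk) φ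

lemma pderiv_spaceTime_test (φ : STTest) (v : ℝ × Space) :
    pderiv v (fun t x => φ (t, x)) = fun t x => (∂_{v} φ) (t, x) := by
  funext t x
  exact (lineDeriv_test_apply φ v (t, x)).symm

lemma balanceResidual_eq {f r : ℝ → L2} {g : Fin 3 → ℝ → L2} (hf : Continuous f)
    (hg : ∀ i, Continuous (g i)) (hr : Continuous r) (φ : STTest) :
    balanceResidual f g r φ =
      pairL2 f (∂_{((1 : ℝ), (0 : Space))} φ) + ∑ i, pairL2 (g i) (∂_{((0 : ℝ), e i)} φ)
        + pairL2 r φ := by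
  have hf_int := integrable_inner_toL2_test hf (∂_{((1 : ℝ), (0 : Space))} φ)
  have hg_int (i : Fin 3) := integrable_inner_toL2_test (hg i) (∂_{((0 : ℝ), e i)} φ)
  have hg_sum_int := integrable_finsetSum Finset.univ fun i _ => hg_int i
  simp only [balanceResidual, balancePairing, pairL2, pderiv_spaceTime_test]
  rw [integral_add _ (integrable_inner_toL2_test hr φ), integral_add hf_int hg_sum_int,
    integral_finsetSum _ fun i _ => hg_int i]
  exact hf_int.add hg_sum_int

lemma weakResidual_eq {ι : Type*} [Fintype ι] {A : Fin 3 → Matrix ι ι ℝ} {V S : ℝ → L2Tuple ι}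
    (hV : Continuous V) (hS : Continuous S) (c : ℝ) (k : ι) (φ : STTest) :
    weakResidual A c V S k φ =
      pairL2 (fun t => V t k) (∂_{((1 : ℝ), (0 : Space))} φ)
        - c * ∑ i, ∑ l, A i k l * pairL2 (fun t => V t l) (∂_{((0 : ℝ), e i)} φ)
        + pairL2 (fun t => S t k) φ := by
  have hflux (i : Fin 3) (ψ : STTest) :
      pairL2 (flux A c V k i) ψ = -c * ∑ l, A i k l * pairL2 (fun t => V t l) ψ := by
    have hterm (l : ι) : Continuous fun t => A i k l • V t l :=
      (continuous_tuple_apply hV l).const_smul (A i k l)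
    unfold flux
    rw [pairL2_smul, pairL2_sum _ fun l _ => hterm l]
    simp only [pairL2_smul]
  rw [weakResidual, balanceResidual_eq (continuous_tuple_apply hV k) (continuous_flux hV c k)
    (continuous_tuple_apply hS k)]
  simp only [hflux, neg_mul, Finset.sum_neg_distrib, ← Finset.mul_sum, ← sub_eq_add_neg]

lemma chargeContinuity_iff {ρ : ℝ → L2} {j : ℝ → L2V} (hρ : Continuous ρ) (hj : Continuous j) :
    ChargeContinuity ρ j ↔ IsBalanceLaw ρ (fun i t => coord i (j t)) fun _ => 0 := by
  have hcoord (i : Fin 3) : Continuous fun t => coord i (j t) := (coord i).continuous.comp hj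
  refine forall_congr' fun φ => ?_
  rw [balanceResidual_eq hρ hcoord continuous_const, pairL2_zero,
    dt_eq_pairL2, divST]
  simp only [dx_comp_eq_pairL2, Finset.sum_neg_distrib]
  rw [add_zero, ← neg_add, neg_eq_zero]

end Pairing

section FirstOrderSystem

/-- The components of the electric and the magnetic field, and two auxiliary scalar fields, one for
each of the divergence equations. -/
abbrev Idx : Type := (Fin 3 ⊕ Fin 3) ⊕ (Unit ⊕ Unit)

/-- The index of the `i`-th component of the electric field. -/
abbrev electric (i : Fin 3) : Idx := Sum.inl (Sum.inl i)

/-- The index of the `i`-th component of the magnetic field. -/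
abbrev magnetic (i : Fin 3) : Idx := Sum.inl (Sum.inr i)

/-- The index of the auxiliary field of the equation for `div E`. -/
abbrev electricAux : Idx := Sum.inr (Sum.inl ())

/-- The index of the auxiliary field of the equation for `div B`. -/
abbrev magneticAux : Idx := Sum.inr (Sum.inr ())

/-- The totally antisymmetric symbol. -/
def leviCivita (i j k : Fin 3) : ℤ :=
  if j = i + 1 ∧ k = i + 2 then 1 else if j = i + 2 ∧ k = i + 1 then -1 else 0

/-- The coefficients of the system `∂ₜE = rot B - ∇f`, `∂ₜB = -rot E - ∇g`, `∂ₜf = -div E`,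
`∂ₜg = -div B`. They are integers, so that identities between them can be decided. -/
def maxwellCoeff (i : Fin 3) : Matrix Idx Idx ℤ :=
  Matrix.fromBlocks
    (Matrix.fromBlocks 0 (Matrix.of fun k l => leviCivita k i l)
      (Matrix.of fun k l => -leviCivita k i l) 0)
    (Matrix.fromBlocks (Matrix.of fun k _ => if k = i then -1 else 0) 0 0
      (Matrix.of fun k _ => if k = i then -1 else 0))
    (Matrix.fromBlocks (Matrix.of fun _ k => if k = i then -1 else 0) 0 0
      (Matrix.of fun _ k => if k = i then -1 else 0)) 0

/-- The matrices `maxwellCoeff` with real entries. -/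
def maxwellMat (i : Fin 3) : Matrix Idx Idx ℝ := (maxwellCoeff i).map (Int.castRingHom ℝ)

lemma maxwellMat_apply (i : Fin 3) (k l : Idx) : maxwellMat i k l = (maxwellCoeff i k l : ℝ) := rfl

lemma sum_maxwellMat_electric (w : Fin 3 → Idx → ℝ) (k : Fin 3) :
    ∑ i, ∑ l, maxwellMat i (electric k) l * w i l =
      w (k + 1) (magnetic (k + 2)) - w (k + 2) (magnetic (k + 1)) - w k electricAux := by
  fin_cases k <;>
    simp [maxwellMat_apply, maxwellCoeff, leviCivita, Fin.sum_univ_three] <;> ring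

lemma sum_maxwellMat_magnetic (w : Fin 3 → Idx → ℝ) (k : Fin 3) :
    ∑ i, ∑ l, maxwellMat i (magnetic k) l * w i l =
      w (k + 2) (electric (k + 1)) - w (k + 1) (electric (k + 2)) - w k magneticAux := by
  fin_cases k <;>
    simp [maxwellMat_apply, maxwellCoeff, leviCivita, Fin.sum_univ_three] <;> ring

lemma sum_maxwellMat_electricAux (w : Fin 3 → Idx → ℝ) :
    ∑ i, ∑ l, maxwellMat i electricAux l * w i l = -∑ i, w i (electric i) := by
  simp [maxwellMat_apply, maxwellCoeff]

lemma sum_maxwellMat_magneticAux (w : Fin 3 → Idx → ℝ) :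
    ∑ i, ∑ l, maxwellMat i magneticAux l * w i l = -∑ i, w i (magnetic i) := by
  simp [maxwellMat_apply, maxwellCoeff]

lemma isClifford_maxwellMat : IsClifford maxwellMat where
  symm i := by
    have h : ∀ i, (maxwellCoeff i).IsSymm := by
      unfold Matrix.IsSymm
      decide +kernel
    exact (h i).map _
  anticomm i j := by
    have h : ∀ i j, maxwellCoeff i * maxwellCoeff j + maxwellCoeff j * maxwellCoeff i =
        if i = j then 2 else 0 := by decide +kernel
    have hmap := congrArg (Int.castRingHom ℝ).mapMatrix (h i j)
    simp only [map_add, map_mul] at hmap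
    refine hmap.trans ?_
    split_ifs
    · exact map_ofNat (Int.castRingHom ℝ).mapMatrix 2
    · exact map_zero (Int.castRingHom ℝ).mapMatrix

/-- The state with the electromagnetic field `u` and vanishing auxiliary fields. -/
def state (u : L2V × L2V) : L2Tuple Idx :=
  WithLp.toLp 2 (Sum.elim (Sum.elim (fun i => coord i u.1) fun i => coord i u.2) 0)

/-- The source of the first order system for the charge density `ρ` and the current density `j`. -/
def source (c : ℝ) (ρ : L2) (j : L2V) : L2Tuple Idx :=
  WithLp.toLp 2 (Sum.elim (Sum.elim (fun i => (-(4 * Real.pi)) • coord i j) 0)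
    (Sum.elim (fun _ => (4 * Real.pi * c) • ρ) 0))

lemma continuous_state {u : ℝ → L2V × L2V} (hu : Continuous u) :
    Continuous fun t => state (u t) := by
  refine (PiLp.continuous_toLp 2 _).comp (continuous_pi fun k => ?_)
  rcases k with (k | k) | (_ | _)
  · exact (coord k).continuous.comp hu.fst
  · exact (coord k).continuous.comp hu.snd
  · exact continuous_const
  · exact continuous_const

lemma continuous_source (c : ℝ) {ρ : ℝ → L2} {j : ℝ → L2V} (hρ : Continuous ρ)
    (hj : Continuous j) : Continuous fun t => source c (ρ t) (j t) := by
  refine (PiLp.continuous_toLp 2 _).comp (continuous_pi fun k => ?_)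
  rcases k with (k | _) | (_ | _)
  · exact ((coord k).continuous.comp hj).const_smul (-(4 * Real.pi))
  · exact continuous_const
  · exact hρ.const_smul (4 * Real.pi * c)
  · exact continuous_const

lemma state_injective : Function.Injective state := fun _ _ h =>
  Prod.ext (ext_coord fun i => congrArg (fun w : L2Tuple Idx => w (electric i)) h)
    (ext_coord fun i => congrArg (fun w : L2Tuple Idx => w (magnetic i)) h)

lemma state_ofCoords {V : L2Tuple Idx} (hE : V electricAux = 0) (hB : V magneticAux = 0) :
    state (ofCoords fun i => V (electric i), ofCoords fun i => V (magnetic i)) = V := by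
  ext1 k
  rcases k with (k | k) | (_ | _)
  · exact coord_ofCoords _ k
  · exact coord_ofCoords _ k
  · exact hE.symm
  · exact hB.symm

lemma norm_sq_state (u : L2V × L2V) : ‖state u‖ ^ 2 = ∫ x, (‖u.1 x‖ ^ 2 + ‖u.2 x‖ ^ 2) := by
  rw [integral_add (integrable_norm_sq _) (integrable_norm_sq _), ← sum_norm_sq_coord,
    ← sum_norm_sq_coord, PiLp.norm_sq_eq_of_L2]
  simp [state]

end FirstOrderSystem

section MaxwellResidual

variable {c : ℝ} {ρ : ℝ → L2} {j : ℝ → L2V} {u : ℝ → L2V × L2V}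

lemma weakResidual_electric (hc : c ≠ 0) (hρ : Continuous ρ) (hj : Continuous j)
    (hu : Continuous u) (k : Fin 3) (φ : STTest) :
    weakResidual maxwellMat c (fun t => state (u t)) (fun t => source c (ρ t) (j t))
        (electric k) φ =
      c * (rotST (fun t => (u t).2) k φ - (4 * Real.pi / c * pair (comp j k) φ
        + 1 / c * dt (comp (fun t => (u t).1) k) φ)) := by
  rw [weakResidual_eq (continuous_state hu) (continuous_source c hρ hj), sum_maxwellMat_electric]
  simp only [rotST, dx_comp_eq_pairL2, dt_comp_eq_pairL2, pair_comp_eq_pairL2, state, source,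
    Sum.elim_inl, Sum.elim_inr, Pi.zero_apply, pairL2_smul, pairL2_zero]
  field

lemma weakResidual_magnetic (hc : c ≠ 0) (hρ : Continuous ρ) (hj : Continuous j)
    (hu : Continuous u) (k : Fin 3) (φ : STTest) :
    weakResidual maxwellMat c (fun t => state (u t)) (fun t => source c (ρ t) (j t))
        (magnetic k) φ =
      -c * (rotST (fun t => (u t).1) k φ + 1 / c * dt (comp (fun t => (u t).2) k) φ) := by
  rw [weakResidual_eq (continuous_state hu) (continuous_source c hρ hj), sum_maxwellMat_magnetic]
  simp only [rotST, dx_comp_eq_pairL2, dt_comp_eq_pairL2, state, source,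
    Sum.elim_inl, Sum.elim_inr, Pi.zero_apply, pairL2_zero]
  field

lemma weakResidual_electricAux (hρ : Continuous ρ) (hj : Continuous j) (hu : Continuous u)
    (φ : STTest) :
    weakResidual maxwellMat c (fun t => state (u t)) (fun t => source c (ρ t) (j t))
        electricAux φ =
      -c * (divST (fun t => (u t).1) φ - 4 * Real.pi * pair (fun t => ρ t) φ) := by
  rw [weakResidual_eq (continuous_state hu) (continuous_source c hρ hj),
    sum_maxwellMat_electricAux]
  simp only [divST, dx_comp_eq_pairL2, pair_eq_pairL2, state, source, Sum.elim_inl, Sum.elim_inr,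
    Pi.zero_apply, pairL2_smul, pairL2_zero, Finset.sum_neg_distrib]
  ring

lemma weakResidual_magneticAux (hρ : Continuous ρ) (hj : Continuous j) (hu : Continuous u)
    (φ : STTest) :
    weakResidual maxwellMat c (fun t => state (u t)) (fun t => source c (ρ t) (j t))
        magneticAux φ = -c * divST (fun t => (u t).2) φ := by
  rw [weakResidual_eq (continuous_state hu) (continuous_source c hρ hj),
    sum_maxwellMat_magneticAux]
  simp only [divST, dx_comp_eq_pairL2, state, source, Sum.elim_inl, Sum.elim_inr, Pi.zero_apply,
    pairL2_zero, Finset.sum_neg_distrib]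
  ring

lemma equations_iff (hc : c ≠ 0) (hρ : Continuous ρ) (hj : Continuous j) (hu : Continuous u) :
    Equations c ρ j (fun t => (u t).1) (fun t => (u t).2) ↔
      IsWeakSolution maxwellMat c (fun t => state (u t)) fun t => source c (ρ t) (j t) := by
  constructor
  · rintro ⟨hdivE, hrotE, hdivB, hrotB⟩ ((k | k) | (k | k)) φ
    · rw [weakResidual_electric hc hρ hj hu, hrotB k φ, sub_self, mul_zero]
    · rw [weakResidual_magnetic hc hρ hj hu, hrotE k φ]
      ring
    · rw [weakResidual_electricAux hρ hj hu, hdivE φ, sub_self, mul_zero]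
    · rw [weakResidual_magneticAux hρ hj hu, hdivB φ, mul_zero]
  · refine fun h => ⟨fun φ => ?_, fun k φ => ?_, fun φ => ?_, fun k φ => ?_⟩
    · have hres := (weakResidual_electricAux hρ hj hu φ).symm.trans (h electricAux φ)
      exact sub_eq_zero.1 ((mul_eq_zero.1 hres).resolve_left (neg_ne_zero.2 hc))
    · have hres := (weakResidual_magnetic hc hρ hj hu k φ).symm.trans (h (magnetic k) φ)
      linarith [(mul_eq_zero.1 hres).resolve_left (neg_ne_zero.2 hc)]
    · have hres := (weakResidual_magneticAux hρ hj hu φ).symm.trans (h magneticAux φ)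
      exact (mul_eq_zero.1 hres).resolve_left (neg_ne_zero.2 hc)
    · have hres := (weakResidual_electric hc hρ hj hu k φ).symm.trans (h (electric k) φ)
      exact sub_eq_zero.1 ((mul_eq_zero.1 hres).resolve_left hc)

end MaxwellResidual

/-! ### The Kirchhoff kernel -/

section KirchhoffKernel

lemma integral_surfaceMeasure (r : ℝ) (φ : Test) :
    ∫ x, φ x ∂surfaceMeasure r = r ^ 2 * ∫ y, φ (r • y) ∂sphereMeasure Space := by
  have hcont : Continuous fun y : Space => φ (r • y) := φ.continuous.comp (by fun_prop)
  rw [surfaceMeasure, integral_smul_measure, integral_map (by fun_prop)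
    φ.continuous.aestronglyMeasurable, sphereMeasure,
    integral_map measurable_subtype_coe.aemeasurable hcont.aestronglyMeasurable,
    ENNReal.toReal_ofReal (sq_nonneg r), smul_eq_mul]

lemma K_apply (t : ℝ) (φ : Test) : K t φ = kirchhoff φ t 0 := by
  have hK : K t φ = (4 * Real.pi * t)⁻¹ * ∫ x, φ x ∂surfaceMeasure |t| := rfl
  have hneg := integral_sphereMeasure_neg fun y : Space => φ (t • y)
  have habs : ∫ y, φ (|t| • y) ∂sphereMeasure Space = ∫ y, φ (t • y) ∂sphereMeasure Space := by
    rcases abs_choice t with h | h <;> simp only [h, neg_smul, ← smul_neg, hneg]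
  rw [hK, integral_surfaceMeasure, habs, sq_abs, kirchhoff]
  simp only [zero_add]
  rcases eq_or_ne t 0 with rfl | ht
  · simp
  · field

lemma kirchhoff_shift (y : Space) (φ : Test) (t : ℝ) (x : Space) :
    kirchhoff (shift y φ) t x = kirchhoff φ t (x + y) := by
  have hshift (z : Space) : shift y φ (x + t • z) = φ (x + y + t • z) :=
    congrArg φ (add_right_comm x (t • z) y)
  simp only [kirchhoff, hshift]

lemma K_shift (t : ℝ) (y : Space) (φ : Test) : K t (shift y φ) = kirchhoff φ t y := by
  rw [K_apply, kirchhoff_shift, zero_add]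

lemma lineDeriv_shift (v y : Space) (φ : Test) : ∂_{v} (shift y φ) = shift y (∂_{v} φ) := by
  ext x
  rw [lineDeriv_test_apply]
  change fderiv ℝ (fun x => φ (x + y)) x v = (∂_{v} φ) (x + y)
  rw [fderiv_comp_add_right, lineDeriv_test_apply]

lemma lineDeriv_K_shift (t : ℝ) (v y : Space) (φ : Test) :
    (∂_{v} (K t)) (shift y φ) = -kirchhoff (∂_{v} φ) t y := by
  rw [Distribution.lineDerivOp_apply_apply, map_neg, lineDeriv_shift, K_shift]

lemma continuous_integral_mul_test {E : Type*} [NormedAddCommGroup E] [NormedSpace ℝ E]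
    [MeasurableSpace E] [OpensMeasurableSpace E] {Ω : Opens E}
    (μ : Measure E) [IsLocallyFiniteMeasure μ] {w : E → ℝ} (hw : Continuous w) :
    Continuous fun φ : 𝓓(Ω, ℝ) => ∫ x, w x * φ x ∂μ := by
  have hw_int : LocallyIntegrableOn w (Ω : Set E) μ := hw.locallyIntegrable.locallyIntegrableOn _
  refine (TestFunction.integralAgainstBilinCLM (n := ⊤) (Ω := Ω)
    (ContinuousLinearMap.mul ℝ ℝ) μ w).continuous.congr fun φ => ?_
  rw [TestFunction.integralAgainstBilinCLM_eq_integral hw_int]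
  simp only [ContinuousLinearMap.mul_apply', mul_comm]

lemma fderiv_test_apply_eq_sum (φ : Test) (x y : Space) :
    fderiv ℝ φ x y = ∑ i, y i * (∂_{e i} φ) x := by
  conv_lhs => rw [← (EuclideanSpace.basisFun (Fin 3) ℝ).sum_repr y]
  simp only [map_sum, map_smul, smul_eq_mul, lineDeriv_test_apply, EuclideanSpace.basisFun_repr,
    EuclideanSpace.basisFun_apply]

lemma pderiv_time_kirchhoff_apply_zero (t : ℝ) (φ : Test) :
    pderiv timeDir (kirchhoff φ) t 0 =
      1 / (4 * Real.pi) * (∫ z, 1 * φ z ∂(sphereMeasure Space).map (t • ·)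
        + ∑ i, ∫ z, z i * (∂_{e i} φ) z ∂(sphereMeasure Space).map (t • ·)) := by
  have hsmul : AEMeasurable (fun y : Space => t • y) (sphereMeasure Space) := by fun_prop
  have hcont (i : Fin 3) : Continuous fun z : Space => z i * (∂_{e i} φ) z :=
    (by fun_prop : Continuous fun z : Space => z i).mul (∂_{e i} φ).continuous
  have hcont' (i : Fin 3) : Continuous fun y : Space => y i * (∂_{e i} φ) (t • y) :=
    (by fun_prop : Continuous fun z : Space => z i).mul
      ((∂_{e i} φ).continuous.comp (by fun_prop))
  simp only [one_mul, integral_map hsmul φ.continuous.aestronglyMeasurable,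
    integral_map hsmul (hcont _).aestronglyMeasurable, PiLp.smul_apply, smul_eq_mul, mul_assoc t,
    integral_const_mul, pderiv_time_kirchhoff, zero_add, fderiv_test_apply_eq_sum]
  rw [integral_finsetSum _ fun i _ => integrable_sphereMeasure (hcont' i), ← Finset.mul_sum]
  ring

/-- The time derivative of the Kirchhoff kernel. -/
def kirchhoffDeriv (t : ℝ) : Dist where
  toFun φ := pderiv timeDir (kirchhoff φ) t 0
  map_add' φ ψ := by
    have hadd : kirchhoff (φ + ψ) = fun t x => kirchhoff φ t x + kirchhoff ψ t x :=
      funext₂ (kirchhoff_add φ ψ)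
    rw [hadd, (isTestCurve_kirchhoff _).pderiv_add (isTestCurve_kirchhoff _)]
  map_smul' a φ := by
    have hsmul : kirchhoff (a • φ) = fun t x => a * kirchhoff φ t x :=
      funext₂ (kirchhoff_smul a φ)
    rw [hsmul, (isTestCurve_kirchhoff _).pderiv_const_mul]
    rfl
  cont := by
    simp only [pderiv_time_kirchhoff_apply_zero]
    have hradial (i : Fin 3) : Continuous fun φ : Test =>
        ∫ z, z i * (∂_{e i} φ) z ∂(sphereMeasure Space).map (t • ·) :=
      (continuous_integral_mul_test _ (by fun_prop)).comp
        (LineDeriv.continuous_lineDerivOp (e i))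
    exact ((continuous_integral_mul_test _ continuous_const).add
      (continuous_finsetSum _ fun i _ => hradial i)).const_mul _

lemma hasDerivAt_K_kirchhoffDeriv (t : ℝ) (φ : Test) :
    HasDerivAt (fun τ => K τ φ) (kirchhoffDeriv t φ) t := by
  simp only [K_apply]
  exact (isTestCurve_kirchhoff φ).hasDerivAt_time t 0

lemma hasDerivAt_K (t : ℝ) (φ : Test) : HasDerivAt (fun τ => K τ φ) (timeDeriv K t φ) t := by
  have hexists : ∃ D : Dist, ∀ φ : Test, HasDerivAt (fun τ => K τ φ) (D φ) t :=
    ⟨_, hasDerivAt_K_kirchhoffDeriv t⟩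
  rw [timeDeriv, dif_pos hexists]
  exact hexists.choose_spec φ

lemma timeDeriv_K_shift (t : ℝ) (y : Space) (φ : Test) :
    timeDeriv K t (shift y φ) = pderiv timeDir (kirchhoff φ) t y := by
  have hderiv := hasDerivAt_K t (shift y φ)
  simp only [K_shift] at hderiv
  exact hderiv.unique ((isTestCurve_kirchhoff φ).hasDerivAt_time t y)

end KirchhoffKernel

/-! ### Huygens' principle -/

section Huygens

lemma K_isVanishingOn (t : ℝ) :
    Distribution.IsVanishingOn (K t) (Metric.sphere (0 : Space) |t|)ᶜ := by
  intro φ hφ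
  rw [K_apply, kirchhoff]
  refine mul_eq_zero_of_right _ (integral_eq_zero_of_ae ?_)
  filter_upwards [ae_norm_eq_one_sphereMeasure (E := Space)] with y hy
  refine image_eq_zero_of_notMem_tsupport fun hmem => hφ hmem ?_
  simp [norm_smul, hy]

lemma timeDeriv_K_isVanishingOn (t : ℝ) :
    Distribution.IsVanishingOn (timeDeriv K t) (Metric.sphere (0 : Space) |t|)ᶜ := by
  intro φ hφ
  rw [(hasDerivAt_K t φ).unique (hasDerivAt_K_kirchhoffDeriv t φ)]
  change pderiv timeDir (kirchhoff φ) t 0 = 0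
  have hnotMem {y : Space} (hy : ‖y‖ = 1) : 0 + t • y ∉ tsupport φ := fun hmem =>
    hφ hmem (by simp [norm_smul, hy])
  rw [pderiv_time_kirchhoff, integral_eq_zero_of_ae, integral_eq_zero_of_ae]
  · simp
  · filter_upwards [ae_norm_eq_one_sphereMeasure (E := Space)] with y hy
    rw [image_eq_zero_of_notMem_tsupport fun hmem =>
      hnotMem hy (tsupport_fderiv_subset ℝ hmem)]
    rfl
  · filter_upwards [ae_norm_eq_one_sphereMeasure (E := Space)] with y hy
    exact image_eq_zero_of_notMem_tsupport (hnotMem hy)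

/-- The distributions which vanish on the set `s`. -/
def vanishingOn {E : Type*} [NormedAddCommGroup E] [NormedSpace ℝ E] (Ω : Opens E) (F : Type*)
    [AddCommGroup F] [Module ℝ F] [TopologicalSpace F] [IsTopologicalAddGroup F]
    [ContinuousSMul ℝ F] (s : Set E) : Submodule ℝ 𝓓'(Ω, F) where
  carrier := {T | Distribution.IsVanishingOn T s}
  zero_mem' _ _ := rfl
  add_mem' {S T} hS hT φ hφ := by
    change S φ + T φ = 0
    rw [hS φ hφ, hT φ hφ, add_zero]
  smul_mem' a T hT φ hφ := by
    change a • T φ = 0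
    rw [hT φ hφ, smul_zero]

lemma diagonal_mem_vanishingOn {n : Type*} [DecidableEq n] {s : Set Space} {T : Dist}
    (hT : T ∈ vanishingOn ⊤ ℝ s) (i k : n) :
    Matrix.diagonal (fun _ => T) i k ∈ vanishingOn ⊤ ℝ s := by
  rw [Matrix.diagonal_apply]
  split_ifs
  · exact hT
  · exact zero_mem _

lemma rotMat_mem_vanishingOn {s : Set Space} {T : Dist} (hT : T ∈ vanishingOn ⊤ ℝ s)
    (i k : Fin 3) : rotMat T i k ∈ vanishingOn ⊤ ℝ s := by
  have hderiv (v : Space) : ∂_{v} T ∈ vanishingOn ⊤ ℝ s :=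
    Distribution.IsVanishingOn.lineDerivOp hT v
  fin_cases i <;> fin_cases k <;>
    first
    | exact zero_mem _
    | exact hderiv _
    | exact neg_mem (hderiv _)

lemma M_isVanishingOn {c : ℝ} (hc : 0 ≤ c) (t : ℝ) (i k : Fin 3 ⊕ Fin 3) :
    Distribution.IsVanishingOn (M c t i k) (Metric.sphere (0 : Space) (c * |t|))ᶜ := by
  rw [show c * |t| = |c * t| by rw [abs_mul, abs_of_nonneg hc]]
  have hrot := rotMat_mem_vanishingOn (K_isVanishingOn (c * t))
  have hdiag := diagonal_mem_vanishingOn (n := Fin 3) (timeDeriv_K_isVanishingOn (c * t))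
  rcases i with i | i <;> rcases k with k | k
  · exact hdiag i k
  · exact hrot i k
  · exact neg_mem (hrot i k)
  · exact hdiag i k

lemma G_isVanishingOn {c : ℝ} (hc : 0 ≤ c) (t : ℝ) (i : Fin 3 ⊕ Fin 3) (k : Unit ⊕ Fin 3) :
    Distribution.IsVanishingOn (G c t i k) (Metric.sphere (0 : Space) (c * |t|))ᶜ := by
  rw [show c * |t| = |c * t| by rw [abs_mul, abs_of_nonneg hc]]
  have hK := K_isVanishingOn (c * t)
  have hdiag := diagonal_mem_vanishingOn (n := Fin 3) (timeDeriv_K_isVanishingOn (c * t))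
  refine (vanishingOn ⊤ ℝ _).smul_mem c ?_
  rcases i with i | i <;> rcases k with _ | k
  · exact neg_mem (hK.lineDerivOp (e i))
  · exact neg_mem (hdiag i k)
  · exact zero_mem _
  · exact rotMat_mem_vanishingOn hK i k

end Huygens

/-! ### The convolution representation -/

section Convolution

lemma kirchhoff_zero_test (t : ℝ) (x : Space) : kirchhoff 0 t x = 0 := by
  simpa only [zero_smul, zero_mul] using kirchhoff_smul 0 0 t x

lemma flow_single {ι : Type*} [Fintype ι] [DecidableEq ι] (A : Fin 3 → Matrix ι ι ℝ) (c : ℝ)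
    (k l : ι) (φ : Test) (t : ℝ) (x : Space) :
    flow A c (Pi.single k φ) l t x =
      (if l = k then pderiv timeDir (kirchhoff φ) (c * t) x else 0)
        + ∑ i, A i l k * kirchhoff (∂_{e i} φ) (c * t) x := by
  have hzero : kirchhoff 0 = fun _ _ => 0 := funext₂ kirchhoff_zero_test
  unfold flow
  congr 1
  · split_ifs with h
    · rw [h, Pi.single_eq_same]
    · rw [Pi.single_eq_of_ne h, hzero]
      simp [pderiv]
  · refine Finset.sum_congr rfl fun i _ => ?_
    rw [Finset.sum_eq_single k _ (by simp), Pi.single_eq_same]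
    intro m _ hm
    rw [Pi.single_eq_of_ne hm, LineDeriv.lineDerivOp_zero, kirchhoff_zero_test, mul_zero]

lemma inner_tupleL2_flow_single {ι : Type*} [Fintype ι] [DecidableEq ι]
    {A : Fin 3 → Matrix ι ι ℝ} (hA : ∀ i, (A i).IsSymm) (V : L2Tuple ι) (c t : ℝ) (k : ι)
    (ψ : Test) :
    inner ℝ V (tupleL2 fun l => flow A c (Pi.single k ψ) l t) =
      inner ℝ (V k) (toL2 (pderiv timeDir (kirchhoff ψ) (c * t)))
        + ∑ i, ∑ l, A i k l * inner ℝ (V l) (toL2 (kirchhoff (∂_{e i} ψ) (c * t))) := by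
  have htime := ((isTestCurve_kirchhoff ψ).pderiv timeDir).memLp (c * t)
  have hspace (i : Fin 3) := (isTestCurve_kirchhoff (∂_{e i} ψ)).memLp (c * t)
  have hflow (l : ι) : toL2 (flow A c (Pi.single k ψ) l t) =
      (if l = k then (1 : ℝ) else 0) • toL2 (pderiv timeDir (kirchhoff ψ) (c * t))
        + ∑ i, A i k l • toL2 (kirchhoff (∂_{e i} ψ) (c * t)) := by
    have happly : flow A c (Pi.single k ψ) l t = fun x =>
        (if l = k then 1 else 0) * pderiv timeDir (kirchhoff ψ) (c * t) x
          + ∑ i, A i l k * kirchhoff (∂_{e i} ψ) (c * t) x := by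
      funext x
      rw [flow_single, boole_mul]
    rw [happly, toL2_add (htime.const_mul _) (memLp_finsetSum _ fun i _ => (hspace i).const_mul _),
      toL2_const_mul htime, toL2_sum _ fun i _ => (hspace i).const_mul _]
    simp only [toL2_const_mul (hspace _), (hA _).apply]
  simp only [inner_tupleL2, hflow, inner_add_right, inner_sum, inner_smul_right,
    Finset.sum_add_distrib, ite_mul, one_mul, zero_mul, Finset.sum_ite_eq', Finset.mem_univ,
    if_true]
  rw [Finset.sum_comm]

lemma rotMat_K_shift (t : ℝ) (y : Space) (φ : Test) (i k : Fin 3) :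
    rotMat (K t) i k (shift y φ) =
      -∑ l, (leviCivita i l k : ℝ) * kirchhoff (∂_{e l} φ) t y := by
  fin_cases i <;> fin_cases k <;>
    simp [rotMat, leviCivita, lineDeriv_shift, K_shift]

lemma diagonal_timeDeriv_K_shift {n : Type*} [DecidableEq n] (t : ℝ) (y : Space) (φ : Test)
    (i k : n) :
    Matrix.diagonal (fun _ => timeDeriv K t) i k (shift y φ) =
      if i = k then pderiv timeDir (kirchhoff φ) t y else 0 := by
  rw [Matrix.diagonal_apply]
  split_ifs
  · exact timeDeriv_K_shift t y φ
  · rfl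

/- The kernels evolve fields and the flow evolves test functions, so time is reversed. -/
lemma M_shift (c t : ℝ) (y : Space) (φ : Test) (k l : Fin 3 ⊕ Fin 3) :
    M c t k l (shift y φ) =
      flow maxwellMat c (Pi.single (Sum.inl k) φ) (Sum.inl l) (-t) y := by
  simp only [flow_single, mul_neg, pderiv_time_kirchhoff_neg, kirchhoff_neg]
  rcases k with k | k <;> rcases l with l | l
  · refine (diagonal_timeDeriv_K_shift (c * t) y φ k l).trans ?_
    simp [maxwellMat_apply, maxwellCoeff, eq_comm]
  · refine (rotMat_K_shift (c * t) y φ k l).trans ?_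
    simp only [(isClifford_maxwellMat.symm _).apply (electric k) (magnetic l)]
    simp [maxwellMat_apply, maxwellCoeff]
  · refine (congrArg Neg.neg (rotMat_K_shift (c * t) y φ k l)).trans ?_
    simp only [(isClifford_maxwellMat.symm _).apply (magnetic k) (electric l)]
    simp [maxwellMat_apply, maxwellCoeff]
  · refine (diagonal_timeDeriv_K_shift (c * t) y φ k l).trans ?_
    simp [maxwellMat_apply, maxwellCoeff, eq_comm]

lemma G_shift_charge (c t : ℝ) (y : Space) (φ : Test) (k : Fin 3 ⊕ Fin 3) :
    G c t k (Sum.inl ()) (shift y φ) =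
      c * flow maxwellMat c (Pi.single (Sum.inl k) φ) electricAux (-t) y := by
  simp only [flow_single, mul_neg, pderiv_time_kirchhoff_neg, kirchhoff_neg]
  rcases k with k | k
  · refine (congrArg (fun a => c * -a) (lineDeriv_K_shift (c * t) (e k) y φ)).trans ?_
    simp [maxwellMat_apply, maxwellCoeff]
  · refine (mul_zero c).trans ?_
    simp [maxwellMat_apply, maxwellCoeff]

lemma G_shift_current (c t : ℝ) (y : Space) (φ : Test) (k : Fin 3 ⊕ Fin 3) (l : Fin 3) :
    G c t k (Sum.inr l) (shift y φ) =
      -c * flow maxwellMat c (Pi.single (Sum.inl k) φ) (electric l) (-t) y := by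
  rw [← M_shift, neg_mul, ← mul_neg]
  rcases k with k | k
  · rfl
  · refine congrArg (c * ·) ?_
    exact (neg_neg (rotMat (K (c * t)) k l (shift y φ))).symm

lemma inner_state_tupleL2 (u : L2V × L2V) {f : Idx → Space → ℝ}
    (hf : ∀ k, MemLp (f (Sum.inl k)) 2 volume) :
    inner ℝ (state u) (tupleL2 f) = ∑ k, ∫ x, fieldVec u k x * f (Sum.inl k) x := by
  have hE (i : Fin 3) : inner ℝ (coord i u.1) (toL2 (f (electric i))) =
      ∫ x, fieldVec u (Sum.inl i) x * f (electric i) x := inner_coord i u.1 (hf _)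
  have hB (i : Fin 3) : inner ℝ (coord i u.2) (toL2 (f (magnetic i))) =
      ∫ x, fieldVec u (Sum.inr i) x * f (magnetic i) x := inner_coord i u.2 (hf _)
  simp only [inner_tupleL2, Fintype.sum_sum_type, state, Sum.elim_inl, Sum.elim_inr, Pi.zero_apply,
    inner_zero_left, Finset.sum_const_zero, add_zero, hE, hB]

lemma matConv_M (c t : ℝ) (u : L2V × L2V) (k : Fin 3 ⊕ Fin 3) (φ : Test) :
    matConv (M c t) (fieldVec u) k φ = inner ℝ (state u)
      (tupleL2 fun l => flow maxwellMat c (Pi.single (Sum.inl k) φ) l (-t)) := by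
  rw [inner_state_tupleL2 _ fun l => (isTestCurve_flow c _ _).memLp (-t)]
  simp only [matConv, conv, M_shift]

lemma matConv_G {c : ℝ} (hc : c ≠ 0) (t : ℝ) (ρ : L2) (j : L2V) (k : Fin 3 ⊕ Fin 3) (φ : Test) :
    4 * Real.pi * matConv (G c t) (sourceVec c ρ j) k φ = inner ℝ (source c ρ j)
      (tupleL2 fun l => flow maxwellMat c (Pi.single (Sum.inl k) φ) l (-t)) := by
  let f (l : Idx) : Space → ℝ := flow maxwellMat c (Pi.single (Sum.inl k) φ) l (-t)
  have hflow (l : Idx) : flow maxwellMat c (Pi.single (Sum.inl k) φ) l (-t) = f l := rfl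
  have hf (l : Idx) : MemLp (f l) 2 volume := (isTestCurve_flow c _ l).memLp (-t)
  have hcharge : ∫ y, ρ y * (c * f electricAux y) = c * inner ℝ ρ (toL2 (f electricAux)) := by
    simp only [inner_toL2 _ (hf _), ← integral_const_mul, mul_left_comm]
  have hcurrent (l : Fin 3) : ∫ y, 1 / c * j y l * (-c * f (electric l) y) =
      -inner ℝ (coord l j) (toL2 (f (electric l))) := by
    rw [inner_coord _ _ (hf _), ← integral_neg]
    exact integral_congr_ae (.of_forall fun y => by field)
  simp only [inner_tupleL2, Fintype.sum_sum_type, matConv, conv, sourceVec, Sum.elim_inl,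
    Sum.elim_inr, Finset.univ_unique, Finset.sum_singleton, PUnit.default_eq_unit, G_shift_charge,
    G_shift_current, hflow, hcharge, hcurrent, source, Pi.zero_apply, inner_zero_left,
    Finset.sum_const_zero, inner_smul_left, RCLike.conj_to_real, add_zero, ← Finset.mul_sum,
    Finset.sum_neg_distrib]
  ring

end Convolution

/-! ### The divergence constraints -/

section Constraints

lemma toL2_kirchhoff_lineDeriv (ψ : Test) (t : ℝ) (v : Space) :
    toL2 (kirchhoff (∂_{v} ψ) t) = toL2 (∂_{v} ((isTestCurve_kirchhoff ψ).slice t) : Test) := by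
  congr 1
  funext x
  rw [← pderiv_space_kirchhoff, (isTestCurve_kirchhoff ψ).pderiv_space, lineDeriv_test_apply]
  rfl

lemma HasDiv.sum_inner_kirchhoff {F : L2V} {f : Space → ℝ} (h : HasDiv F f) (ψ : Test) (t : ℝ) :
    ∑ k, inner ℝ (coord k F) (toL2 (kirchhoff (∂_{e k} ψ) t)) =
      -∫ x, f x * kirchhoff ψ t x := by
  simp only [toL2_kirchhoff_lineDeriv, inner_coord _ F (memLp_test _)]
  exact neg_eq_iff_eq_neg.1 (h ((isTestCurve_kirchhoff ψ).slice t))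

lemma inner_tupleL2_flow_electricAux (V : L2Tuple Idx) (c t : ℝ) (ψ : Test) :
    inner ℝ V (tupleL2 fun l => flow maxwellMat c (Pi.single electricAux ψ) l t) =
      inner ℝ (V electricAux) (toL2 (pderiv timeDir (kirchhoff ψ) (c * t)))
        - ∑ i, inner ℝ (V (electric i)) (toL2 (kirchhoff (∂_{e i} ψ) (c * t))) := by
  rw [inner_tupleL2_flow_single isClifford_maxwellMat.symm, sum_maxwellMat_electricAux,
    ← sub_eq_add_neg]

lemma inner_tupleL2_flow_magneticAux (V : L2Tuple Idx) (c t : ℝ) (ψ : Test) :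
    inner ℝ V (tupleL2 fun l => flow maxwellMat c (Pi.single magneticAux ψ) l t) =
      inner ℝ (V magneticAux) (toL2 (pderiv timeDir (kirchhoff ψ) (c * t)))
        - ∑ i, inner ℝ (V (magnetic i)) (toL2 (kirchhoff (∂_{e i} ψ) (c * t))) := by
  rw [inner_tupleL2_flow_single isClifford_maxwellMat.symm, sum_maxwellMat_magneticAux,
    ← sub_eq_add_neg]

lemma balancePairing_kirchhoff (f : ℝ → L2) (g : Fin 3 → ℝ → L2) (ψ : Test) (a b t : ℝ) :
    balancePairing f g (fun _ => 0) (fun s => kirchhoff ψ (a * s + b)) t =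
      a * inner ℝ (f t) (toL2 (pderiv timeDir (kirchhoff ψ) (a * t + b)))
        + ∑ i, inner ℝ (g i t) (toL2 (kirchhoff (∂_{e i} ψ) (a * t + b))) := by
  have hK := isTestCurve_kirchhoff ψ
  have htime : pderiv timeDir (fun s => kirchhoff ψ (a * s + b)) t =
      fun x => a * pderiv timeDir (kirchhoff ψ) (a * t + b) x :=
    funext (hK.pderiv_time_comp_affine a b t)
  have hspace (i : Fin 3) : pderiv (spaceDir i) (fun s => kirchhoff ψ (a * s + b)) t =
      kirchhoff (∂_{e i} ψ) (a * t + b) := by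
    rw [← pderiv_space_kirchhoff]
    exact funext (hK.pderiv_space_comp_affine (e i) a b t)
  simp only [balancePairing, htime, hspace, toL2_const_mul ((hK.pderiv timeDir).memLp _),
    inner_smul_right, inner_zero_left, add_zero]

variable {E₀ B₀ : L2V} {ρ : ℝ → L2} {j : ℝ → L2V}

lemma duhamel_electricAux_eq_zero (c : ℝ) (hρ : Continuous ρ) (hj : Continuous j)
    (hE₀ : HasDiv E₀ fun x => 4 * Real.pi * ρ 0 x) (hcont : ChargeContinuity ρ j) (t : ℝ) :
    duhamel maxwellMat c (state (E₀, B₀)) (fun s => source c (ρ s) (j s)) t electricAux = 0 := by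
  refine eq_zero_of_inner_test_eq_zero fun ψ => ?_
  have hK := isTestCurve_kirchhoff ψ
  have hinitial : inner ℝ (state (E₀, B₀))
      (tupleL2 fun l => flow maxwellMat c (Pi.single electricAux ψ) l (-t)) =
        4 * Real.pi * inner ℝ (ρ 0) (toL2 (kirchhoff ψ (c * 0 + c * -t))) := by
    rw [inner_tupleL2_flow_electricAux, inner_toL2 _ (hK.memLp _), ← integral_const_mul]
    simp only [state, Sum.elim_inl, Sum.elim_inr, Pi.zero_apply, inner_zero_left,
      hE₀.sum_inner_kirchhoff, zero_sub, neg_neg, mul_zero, zero_add, mul_assoc]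
  have hsource (s : ℝ) : inner ℝ (source c (ρ s) (j s))
      (tupleL2 fun l => flow maxwellMat c (Pi.single electricAux ψ) l (s - t)) =
        4 * Real.pi * balancePairing ρ (fun i s => coord i (j s)) (fun _ => 0)
          (fun s => kirchhoff ψ (c * s + c * -t)) s := by
    rw [inner_tupleL2_flow_electricAux, balancePairing_kirchhoff, ← mul_add, ← sub_eq_add_neg]
    simp only [source, Sum.elim_inl, Sum.elim_inr, inner_smul_left, RCLike.conj_to_real,
      ← Finset.mul_sum]
    ring
  have hfinal : toL2 (kirchhoff ψ (c * t + c * -t)) = 0 := by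
    rw [mul_neg, add_neg_cancel, funext (kirchhoff_zero ψ), toL2_zero]
  have hcharge := ((chargeContinuity_iff hρ hj).1 hcont).inner_sub_inner hρ
    (fun i => (coord i).continuous.comp hj) continuous_const (hK.comp_affine c (c * -t)) 0 t
  rw [← inner_testTuple_single, inner_duhamel_testTuple isClifford_maxwellMat c _
    (continuous_source c hρ hj), hinitial]
  simp only [hsource, intervalIntegral.integral_const_mul]
  rw [← hcharge, hfinal, inner_zero_right]
  ring

lemma duhamel_magneticAux_eq_zero (c : ℝ) (hρ : Continuous ρ) (hj : Continuous j)
    (hB₀ : HasDiv B₀ fun _ => 0) (t : ℝ) :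
    duhamel maxwellMat c (state (E₀, B₀)) (fun s => source c (ρ s) (j s)) t magneticAux = 0 := by
  refine eq_zero_of_inner_test_eq_zero fun ψ => ?_
  rw [← inner_testTuple_single, inner_duhamel_testTuple isClifford_maxwellMat c _
    (continuous_source c hρ hj)]
  simp [inner_tupleL2_flow_magneticAux, state, source, hB₀.sum_inner_kirchhoff]

end Constraints

/-! ### Solution of the Cauchy problem -/

section Solution

variable {c : ℝ} {E₀ B₀ : L2V} {ρ : C(ℝ, L2)} {j : C(ℝ, L2V)} {u : C(ℝ, L2V × L2V)}

lemma exists_isSolution (hc : c ≠ 0) (hE₀ : HasDiv E₀ fun x => 4 * Real.pi * ρ 0 x)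
    (hB₀ : HasDiv B₀ fun _ => 0) (hcont : ChargeContinuity ρ j) :
    ∃ u, IsSolution c E₀ B₀ ρ j u := by
  have hS := continuous_source c ρ.continuous j.continuous
  let V := duhamel maxwellMat c (state (E₀, B₀)) fun s => source c (ρ s) (j s)
  have hV : Continuous V := continuous_duhamel isClifford_maxwellMat c _ hS
  let u : C(ℝ, L2V × L2V) :=
    ⟨fun t => (ofCoords fun i => V t (electric i), ofCoords fun i => V t (magnetic i)),
      (continuous_ofCoords fun i => continuous_tuple_apply hV _).prodMk
        (continuous_ofCoords fun i => continuous_tuple_apply hV _)⟩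
  have hu : (fun t => state (u t)) = V := by
    funext t
    exact state_ofCoords (duhamel_electricAux_eq_zero c ρ.continuous j.continuous hE₀ hcont t)
      (duhamel_magneticAux_eq_zero c ρ.continuous j.continuous hB₀ t)
  refine ⟨u, (equations_iff hc ρ.continuous j.continuous u.continuous).2 ?_, ?_⟩
  · rw [hu]
    exact isWeakSolution_duhamel isClifford_maxwellMat c _ hS
  · exact state_injective ((congrFun hu 0).trans (duhamel_zero isClifford_maxwellMat c _ _))

lemma IsSolution.isWeakSolution (h : IsSolution c E₀ B₀ ρ j u) (hc : c ≠ 0) :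
    IsWeakSolution maxwellMat c (fun t => state (u t)) fun t => source c (ρ t) (j t) :=
  (equations_iff hc ρ.continuous j.continuous u.continuous).1 h.equations

lemma IsSolution.state_eq_duhamel (h : IsSolution c E₀ B₀ ρ j u) (hc : c ≠ 0) (t : ℝ) :
    state (u t) = duhamel maxwellMat c (state (E₀, B₀)) (fun s => source c (ρ s) (j s)) t := by
  rw [← h.initial]
  exact (h.isWeakSolution hc).eq_duhamel isClifford_maxwellMat (continuous_state u.continuous)
    (continuous_source c ρ.continuous j.continuous) t

lemma IsSolution.unique {v : C(ℝ, L2V × L2V)} (hu : IsSolution c E₀ B₀ ρ j u)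
    (hv : IsSolution c E₀ B₀ ρ j v) (hc : c ≠ 0) : u = v := by
  ext1 t
  exact state_injective ((hu.state_eq_duhamel hc t).trans (hv.state_eq_duhamel hc t).symm)

lemma IsSolution.integral_norm_sq (h : IsSolution c E₀ B₀ ρ j u) (hc : c ≠ 0)
    (hj : ∀ t, j t = 0) (t : ℝ) :
    ∫ x, (‖(u t).1 x‖ ^ 2 + ‖(u t).2 x‖ ^ 2) = ∫ x, (‖E₀ x‖ ^ 2 + ‖B₀ x‖ ^ 2) := by
  -- The charge only enters the equation of `electricAux`, where `state` vanishes.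
  have hwork (t : ℝ) : inner ℝ (state (u t)) (source c (ρ t) (j t)) = 0 := by
    rw [PiLp.inner_apply]
    simp [Fintype.sum_sum_type, state, source, hj]
  have hderiv (t : ℝ) : HasDerivAt (fun t => ‖state (u t)‖ ^ 2) 0 t := by
    have henergy := hasDerivAt_norm_sq_duhamel isClifford_maxwellMat c (state (E₀, B₀))
      (continuous_source c ρ.continuous j.continuous) t
    simp only [← h.state_eq_duhamel hc] at henergy
    rwa [hwork, mul_zero] at henergy
  rw [← norm_sq_state, ← norm_sq_state (E₀, B₀), ← h.initial]
  exact is_const_of_deriv_eq_zero (fun t => (hderiv t).differentiableAt)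
    (fun t => (hderiv t).deriv) t 0

lemma matConv_G_sub (hc : c ≠ 0) (t s : ℝ) (k : Fin 3 ⊕ Fin 3) (φ : Test) :
    matConv (G c (t - s)) (sourceVec c (ρ s) (j s)) k φ =
      (4 * Real.pi)⁻¹ * inner ℝ (source c (ρ s) (j s))
        (tupleL2 fun l => flow maxwellMat c (Pi.single (Sum.inl k) φ) l (s - t)) := by
  rw [← neg_sub t s, ← matConv_G hc, inv_mul_cancel_left₀ (by positivity)]

lemma intervalIntegrable_matConv_G (hc : c ≠ 0) (t : ℝ) (k : Fin 3 ⊕ Fin 3) (φ : Test) :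
    IntervalIntegrable (fun s => matConv (G c (t - s)) (sourceVec c (ρ s) (j s)) k φ)
      volume 0 t := by
  have hflow : Continuous fun s =>
      tupleL2 fun l => flow maxwellMat c (Pi.single (Sum.inl k) φ) l (s - t) :=
    (continuous_tupleL2 fun l => isTestCurve_flow c _ l).comp (continuous_sub_right t)
  simp only [matConv_G_sub hc]
  exact (((continuous_source c ρ.continuous j.continuous).inner hflow).const_mul
    _).intervalIntegrable 0 t

lemma IsSolution.integral_fieldVec (h : IsSolution c E₀ B₀ ρ j u) (hc : c ≠ 0) (t : ℝ)
    (k : Fin 3 ⊕ Fin 3) (φ : Test) :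
    ∫ x, fieldVec (u t) k x * φ x =
      matConv (M c t) (fieldVec (E₀, B₀)) k φ
        + 4 * Real.pi * ∫ s in (0 : ℝ)..t,
          matConv (G c (t - s)) (sourceVec c (ρ s) (j s)) k φ := by
  have hpairing : ∫ x, fieldVec (u t) k x * φ x = inner ℝ (state (u t) (Sum.inl k)) (toL2 φ) := by
    rcases k with i | i
    · exact (inner_coord i (u t).1 (memLp_test φ)).symm
    · exact (inner_coord i (u t).2 (memLp_test φ)).symm
  rw [hpairing, ← inner_testTuple_single, h.state_eq_duhamel hc,
    inner_duhamel_testTuple isClifford_maxwellMat c _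
      (continuous_source c ρ.continuous j.continuous), ← matConv_M]
  simp only [matConv_G_sub hc, intervalIntegral.integral_const_mul]
  rw [mul_inv_cancel_left₀ (by positivity)]

end Solution

end Maxwell

end

theorem mainTheorem10 (c : ℝ) (hc : 0 < c)
    (E₀ B₀ : Maxwell.L2V) (ρ : C(ℝ, Maxwell.L2)) (j : C(ℝ, Maxwell.L2V))
    (hE₀ : Maxwell.HasDiv E₀ (fun x => 4 * Real.pi * ρ 0 x))
    (hB₀ : Maxwell.HasDiv B₀ (fun _ => 0))
    (hcont : Maxwell.ChargeContinuity ρ j) :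
    -- i) existence and uniqueness
    (∃! u : C(ℝ, Maxwell.L2V × Maxwell.L2V), Maxwell.IsSolution c E₀ B₀ ρ j u) ∧
    -- ii) conservation of energy
    ((∀ t, j t = 0) → ∀ u, Maxwell.IsSolution c E₀ B₀ ρ j u →
      ∀ t, ∫ x, (‖(u t).1 x‖ ^ 2 + ‖(u t).2 x‖ ^ 2) = ∫ x, (‖E₀ x‖ ^ 2 + ‖B₀ x‖ ^ 2)) ∧
    -- iii) the Kirchhoff kernel is weakly differentiable in time,
    (∀ t φ, HasDerivAt (fun τ => Maxwell.K τ φ) (Maxwell.timeDeriv Maxwell.K t φ) t) ∧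
    -- the kernels are concentrated on the sphere `|x| = c|t|`,
    (∀ t i k, Distribution.IsVanishingOn (Maxwell.M c t i k)
      (Metric.sphere (0 : Maxwell.Space) (c * |t|))ᶜ) ∧
    (∀ t i k, Distribution.IsVanishingOn (Maxwell.G c t i k)
      (Metric.sphere (0 : Maxwell.Space) (c * |t|))ᶜ) ∧
    -- and the convolution representation holds
    (∀ u, Maxwell.IsSolution c E₀ B₀ ρ j u → ∀ (t : ℝ) (i : Fin 3 ⊕ Fin 3) (φ : Maxwell.Test),
      IntervalIntegrable (fun s => Maxwell.matConv (Maxwell.G c (t - s))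
        (Maxwell.sourceVec c (ρ s) (j s)) i φ) volume 0 t ∧
      ∫ x, Maxwell.fieldVec (u t) i x * φ x =
        Maxwell.matConv (Maxwell.M c t) (Maxwell.fieldVec (E₀, B₀)) i φ +
          4 * Real.pi * ∫ s in (0 : ℝ)..t, Maxwell.matConv (Maxwell.G c (t - s))
            (Maxwell.sourceVec c (ρ s) (j s)) i φ) := by
  obtain ⟨u, hu⟩ := Maxwell.exists_isSolution hc.ne' hE₀ hB₀ hcont
  exact ⟨⟨u, hu, fun v hv => hv.unique hu hc.ne'⟩, fun hj u hu => hu.integral_norm_sq hc.ne' hj,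
    Maxwell.hasDerivAt_K, Maxwell.M_isVanishingOn hc.le, Maxwell.G_isVanishingOn hc.le,
    fun u hu t k φ => ⟨Maxwell.intervalIntegrable_matConv_G hc.ne' t k φ,
      hu.integral_fieldVec hc.ne' t k φ⟩⟩
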